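/- Fix $q\in(0,1)$. Let $\mathcal A_q(SU(2))$ be the unital complex algebra generated by $\alpha,\beta,\gamma,\delta$ with relations $\alpha\beta=q\beta\alpha$, $\alpha\gamma=q\gamma\alpha$, $\beta\delta=q\delta\beta$, $\gamma\delta=q\delta\gamma$, $\beta\gamma=\gamma\beta$, $\alpha\delta-q\beta\gamma=\delta\alpha-q^{-1}\beta\gamma=1$, with the comultiplication $\Delta$ and counit $\varepsilon$ for which $\begin{pmatrix}\alpha&\beta\\ \gamma&\delta\end{pmatrix}$ is a matrix corepresentation. Let $\mathcal U_q(\mathfrak{su}(2))$ be the unital complex algebra generated by $A,B,C,D$ with relations $AD=DA=1$, $AB=qBA$, $AC=q^{-1}CA$, $BC-CB=\frac{A^2-D^2}{q-q^{-1}}$, with $\Delta(A)=A\otimes A$, $\Delta(D)=D\otimes D$, $\Delta(B)=A\otimes B+B\otimes D$, $\Delta(C)=A\otimes C+C\otimes D$, $\varepsilon(A)=\varepsilon(D)=1$, $\varepsilon(B)=\varepsilon(C)=0$. Let $\langle\cdot,\cdot\rangle$ be the pairing of $\mathcal U_q(\mathfrak{su}(2))$ and $\mathcal A_q(SU(2))$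 determined by $\langle XY,\xi\rangle=\langle X\otimes Y,\Delta(\xi)\rangle$, $\langle X,\xi\eta\rangle=\langle\Delta(X),\xi\otimes\eta\rangle$, $\langle 1,\xi\rangle=\varepsilon(\xi)$, $\langle X,1\rangle=\varepsilon(X)$ and by the following values on the matrix $\begin{pmatrix}\alpha&\beta\\ \gamma&\delta\end{pmatrix}$: $A\mapsto\mathrm{diag}(q^{1/2},q^{-1/2})$, $D\mapsto\mathrm{diag}(q^{-1/2},q^{1/2})$, $B\mapsto\begin{pmatrix}0&1\\0&0\end{pmatrix}$, $C\mapsto\begin{pmatrix}0&0\\1&0\end{pmatrix}$. Put $X.\xi=(\mathrm{id}\otimes\langle X,\cdot\rangle)\Delta(\xi)$. For $l\in\{0,\tfrac12,1,\dots\}$ let $t^l$ be the representation of $\mathcal U_q(\mathfrak{su}(2))$ on a Hilbert space with orthonormal basis $e^l_n$, $n=-l,-l+1,\dots,l$ (with $e^l_{\pm(l+1)}=0$), given by $$t^l(A)e^l_n=q^{-n}e^l_n,\qquad t^l(D)e^l_n=q^ne^l_n,$$ $$t^l(B)e^l_n=\frac{\sqrt{(q^{-l+n-1}-q^{l-n+1})(q^{-l-n}-q^{l+n})}}{q^{-1}-q}\,e^l_{n-1},\qquad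 t^l(C)e^l_n=\frac{\sqrt{(q^{-l+n}-q^{l-n})(q^{-l-n-1}-q^{l+n+1})}}{q^{-1}-q}\,e^l_{n+1}.$$ With $(a;p)_k=\prod_{i=0}^{k-1}(1-ap^i)$, $\left[{n\atop k}\right]_p=(p^n;p^{-1})_k/(p;p)_k$ and $\sigma\in\mathbb R$ put $v^{l,j}(\sigma)=\sum_{n=-l}^l v^{l,j}_n(\sigma)e^l_n$, where $$v^{l,j}_n(\sigma)=C^{l,j}(\sigma)\,i^{n-l}q^{\sigma(l-n)}q^{\frac12(l-n)(l-n-1)}\left(\frac{(q^{4l};q^{-2})_{l-n}}{(q^2;q^2)_{l-n}}\right)^{1/2}\sum_{k=0}^{l-n}\frac{(q^{-2(l-n)};q^2)_k(q^{-2(l-j)};q^2)_k(-q^{-2l-2j-2\sigma};q^2)_k}{(q^{-4l};q^2)_k(q^2;q^2)_k}q^{2k},$$ $$C^{l,j}(\sigma)=q^{l+j}\left[{2l\atop l-j}\right]_{q^2}^{1/2}\left(\frac{1+q^{-4j-2\sigma}}{1+q^{-2\sigma}}\right)^{1/2}\Bigl((-q^{2-2\sigma};q^2)_{l-j}(-q^{2+2\sigma};q^2)_{l+j}\Bigr)^{-1/2}.$$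 For $\sigma,\tau\in\mathbb R$ and $i,j\in\{-l,-l+1,\dots,l\}$ the generalised matrix element $a^l_{i,j}(\tau,\sigma)\in\mathcal A_q(SU(2))$ is the element determined by $\langle X,a^l_{i,j}(\tau,\sigma)\rangle=\langle t^l(X)v^{l,j}(\sigma),v^{l,i}(\tau)\rangle$ for all $X\in\mathcal U_q(\mathfrak{su}(2))$, and $b^l_{i,j}(\tau,\sigma)=A.a^l_{i,j}(\tau,\sigma)$. Finally, for $\sigma,\tau\in\mathbb R$ put $$\gamma_{\tau,\sigma}=-q^{\tau+1/2}\alpha+iq^{\tau+\sigma-1/2}\beta+iq^{1/2}\gamma+q^{\sigma-1/2}\delta,\qquad \delta_{\tau,\sigma}=q^{\tau+\sigma+1/2}\alpha+iq^{\tau-1/2}\beta-iq^{\sigma+1/2}\gamma+q^{-1/2}\delta.$$ **Corollary 6.7.** For all $l\in\{0,\tfrac12,1,\dots\}$, $m\in\{-l,-l+1,\dots,l\}$ and $\sigma,\tau\in\mathbb R$, there is exactly one element $a^l_{l,m}(\tau,\sigma)$ as above, and $$b^l_{l,m}(\tau,\sigma)=E^l_m(\tau,\sigma)\prod_{k=0}^{l+m-1}\delta_{\tau+2l-1-k,\,\sigma+2m-1-k}\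 \prod_{j=0}^{l-m-1}\gamma_{\tau+l-m-1-j,\,\sigma-l+m+1+j},$$ $$E^l_m(\tau,\sigma)=C^{l,m}(\sigma)\,C^{l,l}(\tau)\,q^{\sigma(m-l)}\,q^{\frac12(l-m)(l-m-1)}.$$ Here products are ordered, $\prod_{k=0}^{r}\xi_k=\xi_0\xi_1\cdots\xi_r$, and empty products equal $1$. -/

import Mathlib

open scoped TensorProduct Matrix

noncomputable section

namespace QSU2

/-- The fixed deformation parameter `q ∈ (0,1)`. -/
abbrev Param : Type := Set.Ioo (0 : ℝ) 1

/-- The real power `q ^ x` as a complex number. -/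
def qpow (q : Param) (x : ℝ) : ℂ := (((q : ℝ) ^ x : ℝ) : ℂ)

/-- The parameter `q` as a complex number. -/
def qc (q : Param) : ℂ := ((q : ℝ) : ℂ)

lemma qc_ne_zero (q : Param) : qc q ≠ 0 := by
  have := q.2.1
  simpa [qc] using this.ne'

lemma qpow_ne_zero (q : Param) (x : ℝ) : qpow q x ≠ 0 := by
  have := Real.rpow_pos_of_pos q.2.1 x
  simpa [qpow] using this.ne'

lemma qpow_add (q : Param) (x y : ℝ) : qpow q (x + y) = qpow q x * qpow q y := by
  simp [qpow, Real.rpow_add q.2.1]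

lemma qpow_one (q : Param) : qpow q 1 = qc q := by simp [qpow, qc]

lemma qpow_neg (q : Param) (x : ℝ) : qpow q (-x) = (qpow q x)⁻¹ := by
  simp [qpow, Real.rpow_neg q.2.1.le]

lemma qpow_half_sq (q : Param) : qpow q (1 / 2) * qpow q (1 / 2) = qc q := by
  rw [← qpow_add, ← qpow_one]; norm_num

lemma qc_sub_inv_ne_zero (q : Param) : qc q - (qc q)⁻¹ ≠ 0 := by
  have h0 := q.2.1
  have h1 := q.2.2
  have : (q : ℝ) - (q : ℝ)⁻¹ ≠ 0 := by
    have : 1 < (q : ℝ)⁻¹ := (one_lt_inv₀ h0).2 h1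
    linarith
  unfold qc
  exact_mod_cast this

/-! ### The quantised algebra of polynomials on `SU(2)` -/

/-- The generators of the quantised algebra of polynomials. -/
inductive AGen : Type
  | α | β | γ | δ

/-- The defining relations of the quantised algebra of polynomials. -/
inductive ARel (q : Param) : FreeAlgebra ℂ AGen → FreeAlgebra ℂ AGen → Prop
  | αβ : ARel q (.ι ℂ .α * .ι ℂ .β) (qc q • (.ι ℂ .β * .ι ℂ .α))
  | αγ : ARel q (.ι ℂ .α * .ι ℂ .γ) (qc q • (.ι ℂ .γ * .ι ℂ .α))
  | βδ : ARel q (.ι ℂ .β * .ι ℂ .δ) (qc q • (.ι ℂ .δ * .ι ℂ .β))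
  | γδ : ARel q (.ι ℂ .γ * .ι ℂ .δ) (qc q • (.ι ℂ .δ * .ι ℂ .γ))
  | βγ : ARel q (.ι ℂ .β * .ι ℂ .γ) (.ι ℂ .γ * .ι ℂ .β)
  | αδ : ARel q (.ι ℂ .α * .ι ℂ .δ - qc q • (.ι ℂ .β * .ι ℂ .γ)) 1
  | δα : ARel q (.ι ℂ .δ * .ι ℂ .α - (qc q)⁻¹ • (.ι ℂ .β * .ι ℂ .γ)) 1

/-- The quantised algebra `A_q(SU(2))` of polynomials on `SU(2)`. -/
def Aq (q : Param) : Type := RingQuot (ARel q)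

namespace Aq

variable (q : Param)

instance : Ring (Aq q) := inferInstanceAs (Ring (RingQuot (ARel q)))
instance : Algebra ℂ (Aq q) := inferInstanceAs (Algebra ℂ (RingQuot (ARel q)))

/-- The quotient map from the free algebra. -/
def mk : FreeAlgebra ℂ AGen →ₐ[ℂ] Aq q := RingQuot.mkAlgHom ℂ (ARel q)

/-- The generators as elements of `A_q(SU(2))`. -/
def gen (x : AGen) : Aq q := mk q (FreeAlgebra.ι ℂ x)

variable {q} in
lemma mk_rel {x y : FreeAlgebra ℂ AGen} (h : ARel q x y) : mk q x = mk q y :=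
  RingQuot.mkAlgHom_rel ℂ h

lemma αβ : gen q .α * gen q .β = qc q • (gen q .β * gen q .α) := by
  simpa [gen] using mk_rel (ARel.αβ (q := q))
lemma αγ : gen q .α * gen q .γ = qc q • (gen q .γ * gen q .α) := by
  simpa [gen] using mk_rel (ARel.αγ (q := q))
lemma βδ : gen q .β * gen q .δ = qc q • (gen q .δ * gen q .β) := by
  simpa [gen] using mk_rel (ARel.βδ (q := q))
lemma γδ : gen q .γ * gen q .δ = qc q • (gen q .δ * gen q .γ) := by
  simpa [gen] using mk_rel (ARel.γδ (q := q))
lemma βγ : gen q .β * gen q .γ = gen q .γ * gen q .β := by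
  simpa [gen] using mk_rel (ARel.βγ (q := q))
lemma αδ : gen q .α * gen q .δ = 1 + qc q • (gen q .γ * gen q .β) := by
  have := mk_rel (ARel.αδ (q := q))
  rw [← βγ]
  simpa [gen, sub_eq_iff_eq_add] using this
lemma δα : gen q .δ * gen q .α = 1 + (qc q)⁻¹ • (gen q .γ * gen q .β) := by
  have := mk_rel (ARel.δα (q := q))
  rw [← βγ]
  simpa [gen, sub_eq_iff_eq_add] using this

variable {q} in
/-- An algebra homomorphism out of `A_q(SU(2))` from images of the generators satisfying the
defining relations. -/
def lift {R : Type*} [Ring R] [Algebra ℂ R] (f : AGen → R)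
    (h1 : f .α * f .β = qc q • (f .β * f .α)) (h2 : f .α * f .γ = qc q • (f .γ * f .α))
    (h3 : f .β * f .δ = qc q • (f .δ * f .β)) (h4 : f .γ * f .δ = qc q • (f .δ * f .γ))
    (h5 : f .β * f .γ = f .γ * f .β) (h6 : f .α * f .δ - qc q • (f .β * f .γ) = 1)
    (h7 : f .δ * f .α - (qc q)⁻¹ • (f .β * f .γ) = 1) : Aq q →ₐ[ℂ] R :=
  RingQuot.liftAlgHom ℂ ⟨FreeAlgebra.lift ℂ f, by
    intro x y h
    cases h <;> simp [h1, h2, h3, h4, ← h5] <;> first | exact h6 | exact h7⟩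

variable {q} in
@[simp] lemma lift_gen {R : Type*} [Ring R] [Algebra ℂ R] (f : AGen → R) (h1 h2 h3 h4 h5 h6 h7)
    (x : AGen) : lift (q := q) f h1 h2 h3 h4 h5 h6 h7 (gen q x) = f x := by
  unfold lift gen mk
  erw [RingQuot.liftAlgHom_mkAlgHom_apply]
  simp

variable {q} in
lemma hom_ext {R : Type*} [Semiring R] [Algebra ℂ R] {f g : Aq q →ₐ[ℂ] R}
    (h : ∀ x, f (gen q x) = g (gen q x)) : f = g := by
  apply RingQuot.ringQuot_ext' (S := ℂ)
  apply FreeAlgebra.hom_ext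
  funext x
  exact h x

/-- The comultiplication on generators. -/
def comulGen : AGen → Aq q ⊗[ℂ] Aq q
  | .α => gen q .α ⊗ₜ gen q .α + gen q .β ⊗ₜ gen q .γ
  | .β => gen q .α ⊗ₜ gen q .β + gen q .β ⊗ₜ gen q .δ
  | .γ => gen q .γ ⊗ₜ gen q .α + gen q .δ ⊗ₜ gen q .γ
  | .δ => gen q .γ ⊗ₜ gen q .β + gen q .δ ⊗ₜ gen q .δ

/-- The comultiplication of `A_q(SU(2))`. -/
def comulHom : Aq q →ₐ[ℂ] Aq q ⊗[ℂ] Aq q := by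
  have hq := qc_ne_zero q
  refine lift (comulGen q) ?_ ?_ ?_ ?_ ?_ ?_ ?_ <;>
  · simp only [comulGen, add_mul, mul_add, Algebra.TensorProduct.tmul_mul_tmul, αβ, αγ, βδ, γδ,
      βγ, αδ, δα, TensorProduct.tmul_smul, ← TensorProduct.smul_tmul', TensorProduct.add_tmul,
      TensorProduct.tmul_add, smul_add, smul_smul, Algebra.TensorProduct.one_def]
    match_scalars <;> field_simp <;> ring

/-- The counit of `A_q(SU(2))`: the matrix of generators goes to the identity matrix. -/
def counitHom : Aq q →ₐ[ℂ] ℂ :=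
  lift (fun | .α => 1 | .β => 0 | .γ => 0 | .δ => 1) (by simp) (by simp) (by simp) (by simp)
    (by simp) (by simp) (by simp)

instance : Bialgebra ℂ (Aq q) :=
  Bialgebra.ofAlgHom (comulHom q) (counitHom q)
    (hom_ext fun x ↦ by
      cases x <;> simp [comulHom, comulGen, TensorProduct.add_tmul, TensorProduct.tmul_add] <;> abel)
    (hom_ext fun x ↦ by
      cases x <;> simp [comulHom, comulGen, counitHom])
    (hom_ext fun x ↦ by
      cases x <;> simp [comulHom, comulGen, counitHom])

end Aq

/-! ### The quantised universal enveloping algebra -/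

/-- The generators of the quantised universal enveloping algebra. -/
inductive UGen : Type
  | A | B | C | D

/-- The defining relations of the quantised universal enveloping algebra. -/
inductive URel (q : Param) : FreeAlgebra ℂ UGen → FreeAlgebra ℂ UGen → Prop
  | AD : URel q (.ι ℂ .A * .ι ℂ .D) 1
  | DA : URel q (.ι ℂ .D * .ι ℂ .A) 1
  | AB : URel q (.ι ℂ .A * .ι ℂ .B) (qc q • (.ι ℂ .B * .ι ℂ .A))
  | AC : URel q (.ι ℂ .A * .ι ℂ .C) ((qc q)⁻¹ • (.ι ℂ .C * .ι ℂ .A))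
  | BC : URel q (.ι ℂ .B * .ι ℂ .C - .ι ℂ .C * .ι ℂ .B)
      ((qc q - (qc q)⁻¹)⁻¹ • (.ι ℂ .A * .ι ℂ .A - .ι ℂ .D * .ι ℂ .D))

/-- The quantised universal enveloping algebra `U_q(su(2))`. -/
def Uq (q : Param) : Type := RingQuot (URel q)

namespace Uq

variable (q : Param)

instance : Ring (Uq q) := inferInstanceAs (Ring (RingQuot (URel q)))
instance : Algebra ℂ (Uq q) := inferInstanceAs (Algebra ℂ (RingQuot (URel q)))

/-- The quotient map from the free algebra. -/
def mk : FreeAlgebra ℂ UGen →ₐ[ℂ] Uq q := RingQuot.mkAlgHom ℂ (URel q)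

/-- The generators as elements of `U_q(su(2))`. -/
def gen (x : UGen) : Uq q := mk q (FreeAlgebra.ι ℂ x)

variable {q} in
lemma mk_rel {x y : FreeAlgebra ℂ UGen} (h : URel q x y) : mk q x = mk q y :=
  RingQuot.mkAlgHom_rel ℂ h

lemma AD : gen q .A * gen q .D = 1 := by
  simpa [gen] using mk_rel (URel.AD (q := q))
lemma DA : gen q .D * gen q .A = 1 := by
  simpa [gen] using mk_rel (URel.DA (q := q))
lemma AB : gen q .A * gen q .B = qc q • (gen q .B * gen q .A) := by
  simpa [gen] using mk_rel (URel.AB (q := q))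
lemma AC : gen q .A * gen q .C = (qc q)⁻¹ • (gen q .C * gen q .A) := by
  simpa [gen] using mk_rel (URel.AC (q := q))
lemma BC : gen q .B * gen q .C = gen q .C * gen q .B +
    (qc q - (qc q)⁻¹)⁻¹ • (gen q .A * gen q .A - gen q .D * gen q .D) := by
  have := mk_rel (URel.BC (q := q))
  rw [add_comm]
  simpa [gen, sub_eq_iff_eq_add] using this
lemma DB : gen q .D * gen q .B = (qc q)⁻¹ • (gen q .B * gen q .D) := by
  have h : gen q .D * (gen q .A * gen q .B) * gen q .D =
      gen q .D * (qc q • (gen q .B * gen q .A)) * gen q .D := by rw [AB]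
  rw [← mul_assoc, DA, one_mul, mul_smul_comm, smul_mul_assoc, mul_assoc, mul_assoc, AD,
    mul_one] at h
  rw [h, smul_smul, inv_mul_cancel₀ (qc_ne_zero q), one_smul]
lemma DC : gen q .D * gen q .C = qc q • (gen q .C * gen q .D) := by
  have h : gen q .D * (gen q .A * gen q .C) * gen q .D =
      gen q .D * ((qc q)⁻¹ • (gen q .C * gen q .A)) * gen q .D := by rw [AC]
  rw [← mul_assoc, DA, one_mul, mul_smul_comm, smul_mul_assoc, mul_assoc, mul_assoc, AD,
    mul_one] at h
  rw [h, smul_smul, mul_inv_cancel₀ (qc_ne_zero q), one_smul]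

variable {q} in
/-- An algebra homomorphism out of `U_q(su(2))` from images of the generators satisfying the
defining relations. -/
def lift {R : Type*} [Ring R] [Algebra ℂ R] (f : UGen → R)
    (h1 : f .A * f .D = 1) (h2 : f .D * f .A = 1) (h3 : f .A * f .B = qc q • (f .B * f .A))
    (h4 : f .A * f .C = (qc q)⁻¹ • (f .C * f .A))
    (h5 : f .B * f .C - f .C * f .B =
      (qc q - (qc q)⁻¹)⁻¹ • (f .A * f .A - f .D * f .D)) : Uq q →ₐ[ℂ] R :=
  RingQuot.liftAlgHom ℂ ⟨FreeAlgebra.lift ℂ f, by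
    intro x y h
    cases h <;> simp [h1, h2, h3, h4, h5]⟩

variable {q} in
@[simp] lemma lift_gen {R : Type*} [Ring R] [Algebra ℂ R] (f : UGen → R) (h1 h2 h3 h4 h5)
    (x : UGen) : lift (q := q) f h1 h2 h3 h4 h5 (gen q x) = f x := by
  unfold lift gen mk
  erw [RingQuot.liftAlgHom_mkAlgHom_apply]
  simp

variable {q} in
lemma hom_ext {R : Type*} [Semiring R] [Algebra ℂ R] {f g : Uq q →ₐ[ℂ] R}
    (h : ∀ x, f (gen q x) = g (gen q x)) : f = g := by
  apply RingQuot.ringQuot_ext' (S := ℂ)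
  apply FreeAlgebra.hom_ext
  funext x
  exact h x

variable {q} in
lemma induction {P : Uq q → Prop} (hc : ∀ c : ℂ, P (algebraMap ℂ _ c)) (hg : ∀ x, P (gen q x))
    (hadd : ∀ x y, P x → P y → P (x + y)) (hmul : ∀ x y, P x → P y → P (x * y)) (x : Uq q) :
    P x := by
  obtain ⟨y, rfl⟩ : ∃ y, mk q y = x := RingQuot.mkAlgHom_surjective ℂ (URel q) x
  induction y using FreeAlgebra.induction with
  | grade0 r => rw [AlgHom.commutes]; exact hc r
  | grade1 x => exact hg x
  | mul a b ha hb => rw [map_mul]; exact hmul _ _ ha hb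
  | add a b ha hb => rw [map_add]; exact hadd _ _ ha hb

/-- The comultiplication on generators. -/
def comulGen : UGen → Uq q ⊗[ℂ] Uq q
  | .A => gen q .A ⊗ₜ gen q .A
  | .B => gen q .A ⊗ₜ gen q .B + gen q .B ⊗ₜ gen q .D
  | .C => gen q .A ⊗ₜ gen q .C + gen q .C ⊗ₜ gen q .D
  | .D => gen q .D ⊗ₜ gen q .D

/-- The comultiplication of `U_q(su(2))`. -/
def comulHom : Uq q →ₐ[ℂ] Uq q ⊗[ℂ] Uq q := by
  have hq := qc_ne_zero q
  refine lift (comulGen q) ?_ ?_ ?_ ?_ ?_ <;>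
  · simp only [comulGen, add_mul, mul_add, Algebra.TensorProduct.tmul_mul_tmul, AD, DA, AB, AC, BC,
      DB, DC, TensorProduct.tmul_smul, ← TensorProduct.smul_tmul', TensorProduct.add_tmul,
      TensorProduct.tmul_add, TensorProduct.sub_tmul,
      TensorProduct.tmul_sub, smul_add, smul_sub, Algebra.TensorProduct.one_def]
    try (match_scalars <;> field_simp <;> ring)

/-- The counit of `U_q(su(2))`. -/
def counitHom : Uq q →ₐ[ℂ] ℂ :=
  lift (fun | .A => 1 | .B => 0 | .C => 0 | .D => 1) (by simp) (by simp) (by simp) (by simp)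
    (by simp)

instance : Bialgebra ℂ (Uq q) :=
  Bialgebra.ofAlgHom (comulHom q) (counitHom q)
    (hom_ext fun x ↦ by
      cases x <;> simp [comulHom, comulGen, TensorProduct.add_tmul, TensorProduct.tmul_add] <;> abel)
    (hom_ext fun x ↦ by
      cases x <;> simp [comulHom, comulGen, counitHom])
    (hom_ext fun x ↦ by
      cases x <;> simp [comulHom, comulGen, counitHom])

end Uq

/-! ### The duality between the two algebras -/

/-- The two-dimensional representation `X ↦ ⟨X, (α β; γ δ)⟩` of `U_q(su(2))`. -/
def funRepGen (q : Param) : UGen → Matrix (Fin 2) (Fin 2) ℂ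
  | .A => !![qpow q (1 / 2), 0; 0, qpow q (-(1 / 2))]
  | .B => !![0, 1; 0, 0]
  | .C => !![0, 0; 1, 0]
  | .D => !![qpow q (-(1 / 2)), 0; 0, qpow q (1 / 2)]

/-- The two-dimensional representation `X ↦ ⟨X, (α β; γ δ)⟩` of `U_q(su(2))`. -/
def funRep (q : Param) : Uq q →ₐ[ℂ] Matrix (Fin 2) (Fin 2) ℂ := by
  have hs : qpow q 2⁻¹ * qpow q 2⁻¹ = qc q := by simpa using qpow_half_sq q
  have h0 := qpow_ne_zero q 2⁻¹
  have hq := qc_ne_zero q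
  have hd := qc_sub_inv_ne_zero q
  refine Uq.lift (funRepGen q) ?_ ?_ ?_ ?_ ?_
  · ext i j; fin_cases i <;> fin_cases j <;> simp [funRepGen, qpow_neg, h0]
  · ext i j; fin_cases i <;> fin_cases j <;> simp [funRepGen, qpow_neg, h0]
  · ext i j; fin_cases i <;> fin_cases j <;> simp [funRepGen, qpow_neg, ← hs]
    try field_simp
  · ext i j; fin_cases i <;> fin_cases j <;> simp [funRepGen, qpow_neg, ← hs]
    try field_simp
  · ext i j
    fin_cases i <;> fin_cases j <;> simp [funRepGen, qpow_neg]
    · rw [← mul_inv, hs, inv_mul_cancel₀ hd]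
    · rw [← mul_inv, hs, ← neg_sub (qc q), mul_neg, inv_mul_cancel₀ hd]

/-- The entry `(i, j)` of the two-dimensional representation, as an element of the convolution
algebra of linear functionals on `U_q(su(2))`. -/
def coef (q : Param) (i j : Fin 2) : WithConv (Uq q →ₗ[ℂ] ℂ) :=
  WithConv.toConv (Matrix.entryLinearMap ℂ ℂ i j ∘ₗ (funRep q).toLinearMap)

/-- The tensor square of the two-dimensional representation. -/
def funRepSq (q : Param) : Uq q →ₐ[ℂ] Matrix (Fin 2 × Fin 2) (Fin 2 × Fin 2) ℂ :=
  (Matrix.kroneckerAlgEquiv (Fin 2) (Fin 2) ℂ).toAlgHom.comp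
    ((Algebra.TensorProduct.map (funRep q) (funRep q)).comp (Uq.comulHom q))

lemma coef_mul_coef (q : Param) (i j k l : Fin 2) (X : Uq q) :
    (coef q i j * coef q k l).ofConv X = funRepSq q X (i, k) (j, l) := by
  change LinearMap.mul' ℂ ℂ (TensorProduct.map _ _ (Uq.comulHom q X)) =
    kroneckerLinearEquiv _ _ _ _ ℂ
      (Algebra.TensorProduct.map (funRep q) (funRep q) (Uq.comulHom q X)) (i, k) (j, l)
  generalize Uq.comulHom q X = t
  induction t using TensorProduct.induction_on with
  | zero => simp
  | tmul x y => simp [coef]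
  | add x y hx hy => simp only [map_add, hx, hy, Matrix.add_apply]

/-- The invariant vector of the tensor square of the two-dimensional representation. -/
def invVec (q : Param) : Fin 2 × Fin 2 → ℂ := fun p ↦ !![0, 1; -qc q, 0] p.1 p.2

lemma funRepSq_gen (q : Param) (x : UGen) :
    funRepSq q (Uq.gen q x) *ᵥ invVec q = Uq.counitHom q (Uq.gen q x) • invVec q ∧
    invVec q ᵥ* funRepSq q (Uq.gen q x) = Uq.counitHom q (Uq.gen q x) • invVec q := by
  have hs : qpow q 2⁻¹ * qpow q 2⁻¹ = qc q := by simpa using qpow_half_sq q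
  have h0 := qpow_ne_zero q 2⁻¹
  constructor <;> ext ⟨i, j⟩ <;> cases x <;> fin_cases i <;> fin_cases j <;>
    simp [funRepSq, Uq.comulHom, Uq.comulGen, Uq.counitHom, funRep, funRepGen, Matrix.mulVec,
      Matrix.vecMul, dotProduct, Fintype.sum_prod_type, invVec, qpow_neg, ← hs] <;>
    field_simp <;> simp [h0]

lemma funRepSq_mulVec (q : Param) (X : Uq q) :
    funRepSq q X *ᵥ invVec q = Uq.counitHom q X • invVec q := by
  induction X using Uq.induction with
  | hc c => simp [Algebra.algebraMap_eq_smul_one, Matrix.smul_mulVec]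
  | hg x => exact (funRepSq_gen q x).1
  | hadd x y hx hy => rw [map_add, Matrix.add_mulVec, hx, hy, map_add, add_smul]
  | hmul x y hx hy =>
    rw [map_mul, ← Matrix.mulVec_mulVec, hy, Matrix.mulVec_smul, hx, smul_smul, map_mul, mul_comm]

lemma funRepSq_vecMul (q : Param) (X : Uq q) :
    invVec q ᵥ* funRepSq q X = Uq.counitHom q X • invVec q := by
  induction X using Uq.induction with
  | hc c => simp [Algebra.algebraMap_eq_smul_one, Matrix.vecMul_smul]
  | hg x => exact (funRepSq_gen q x).2
  | hadd x y hx hy => rw [map_add, Matrix.vecMul_add, hx, hy, map_add, add_smul]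
  | hmul x y hx hy =>
    rw [map_mul, ← Matrix.vecMul_vecMul, hx, Matrix.smul_vecMul, hy, smul_smul, map_mul]

/-- The functional `⟨·, x⟩` for a generator `x`. -/
def coefGen (q : Param) : AGen → WithConv (Uq q →ₗ[ℂ] ℂ)
  | .α => coef q 0 0
  | .β => coef q 0 1
  | .γ => coef q 1 0
  | .δ => coef q 1 1

/-- The algebra homomorphism `ξ ↦ ⟨·, ξ⟩` from `A_q(SU(2))` to the convolution algebra of linear
functionals on `U_q(su(2))`, so that `⟨X, ξη⟩ = ⟨Δ(X), ξ ⊗ η⟩` and `⟨X, 1⟩ = ε(X)`. -/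
def pairingHom (q : Param) : Aq q →ₐ[ℂ] WithConv (Uq q →ₗ[ℂ] ℂ) := by
  have hq := qc_ne_zero q
  have hone : ∀ X : Uq q, (1 : WithConv (Uq q →ₗ[ℂ] ℂ)).ofConv X = Uq.counitHom q X :=
    fun X ↦ rfl
  have key1 := fun (X : Uq q) (p : Fin 2 × Fin 2) ↦ congrFun (funRepSq_mulVec q X) p
  have key2 := fun (X : Uq q) (p : Fin 2 × Fin 2) ↦ congrFun (funRepSq_vecMul q X) p
  simp only [Matrix.mulVec, Matrix.vecMul, dotProduct, Fintype.sum_prod_type, Fin.sum_univ_two,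
    invVec, Pi.smul_apply] at key1 key2
  refine Aq.lift (coefGen q) ?_ ?_ ?_ ?_ ?_ ?_ ?_ <;>
  · apply WithConv.ext
    ext X
    have a1 := key1 X (0, 0)
    have a2 := key1 X (0, 1)
    have a3 := key1 X (1, 0)
    have a4 := key1 X (1, 1)
    have b1 := key2 X (0, 0)
    have b2 := key2 X (0, 1)
    have b3 := key2 X (1, 0)
    have b4 := key2 X (1, 1)
    simp at a1 a2 a3 a4 b1 b2 b3 b4
    simp only [coefGen, WithConv.ofConv_smul, WithConv.ofConv_sub, LinearMap.smul_apply,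
      LinearMap.sub_apply, coef_mul_coef, smul_eq_mul, hone]
    first
      | linear_combination a1
      | linear_combination a2
      | linear_combination a4
      | linear_combination b1
      | linear_combination b2
      | linear_combination b4
      | (apply mul_left_cancel₀ hq; linear_combination b2 - a2)
      | (apply mul_left_cancel₀ hq; rw [mul_sub, mul_inv_cancel_left₀ hq]; linear_combination -b3)

/-- The pairing `⟨X, ξ⟩` between `U_q(su(2))` and `A_q(SU(2))`. -/
def pairing (q : Param) : Uq q →ₗ[ℂ] Aq q →ₗ[ℂ] ℂ :=
  ((WithConv.linearEquiv ℂ (Uq q →ₗ[ℂ] ℂ)).toLinearMap ∘ₗ (pairingHom q).toLinearMap).flip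

/-- The left action `X.ξ = (id ⊗ X)(Δ(ξ))` of `U_q(su(2))` on `A_q(SU(2))`. -/
def leftAct (q : Param) (X : Uq q) : Aq q →ₗ[ℂ] Aq q :=
  (TensorProduct.rid ℂ (Aq q)).toLinearMap ∘ₗ (pairing q X).lTensor (Aq q) ∘ₗ
    (Aq.comulHom q).toLinearMap

/-! ### The irreducible representations of `U_q(su(2))`

The spin `l ∈ ½ℤ₊` is encoded by `N = 2l ∈ ℕ` and an index `n ∈ {-l, -l+1, …, l}` by
`k = l + n ∈ {0, …, N}`, so that `l - n = N - k`. -/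

/-- The spin `l = N / 2`. -/
def spin (N : ℕ) : ℝ := N / 2

/-- The index `n = k - l ∈ {-l, …, l}` belonging to `k ∈ {0, …, N}`. -/
def weight (N : ℕ) (k : ℕ) : ℝ := k - spin N

/-- The coefficient of `e_{n-1}` in `t^l(B) e_n`. -/
def lowerCoeff (q : Param) (l n : ℝ) : ℝ :=
  √(((q : ℝ) ^ (-l + n - 1) - (q : ℝ) ^ (l - n + 1)) * ((q : ℝ) ^ (-l - n) - (q : ℝ) ^ (l + n))) /
    ((q : ℝ)⁻¹ - q)

/-- The coefficient of `e_{n+1}` in `t^l(C) e_n`. -/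
def raiseCoeff (q : Param) (l n : ℝ) : ℝ :=
  √(((q : ℝ) ^ (-l + n) - (q : ℝ) ^ (l - n)) * ((q : ℝ) ^ (-l - n - 1) - (q : ℝ) ^ (l + n + 1))) /
    ((q : ℝ)⁻¹ - q)

/-- The matrices of the generators in the representation `t^l`; the column `k` holds the image
of the basis vector `e_n`, `n = k - l`. -/
def spinRepGen (q : Param) (N : ℕ) : UGen → Matrix (Fin (N + 1)) (Fin (N + 1)) ℂ
  | .A => Matrix.diagonal fun k ↦ qpow q (-weight N k)
  | .B => Matrix.of fun i k ↦
      if (i : ℕ) + 1 = k then (lowerCoeff q (spin N) (weight N k) : ℂ) else 0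
  | .C => Matrix.of fun i k ↦
      if (i : ℕ) = k + 1 then (raiseCoeff q (spin N) (weight N k) : ℂ) else 0
  | .D => Matrix.diagonal fun k ↦ qpow q (weight N k)

lemma lowerCoeff_eq (q : Param) (l n : ℝ) : lowerCoeff q l n = raiseCoeff q l (n - 1) := by
  unfold lowerCoeff raiseCoeff
  ring_nf

lemma raiseCoeff_sq (q : Param) (l n : ℝ) (h1 : -l ≤ n) (h2 : n ≤ l) :
    raiseCoeff q l n * raiseCoeff q l n =
      (((q : ℝ) ^ (-l + n) - (q : ℝ) ^ (l - n)) *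
        ((q : ℝ) ^ (-l - n - 1) - (q : ℝ) ^ (l + n + 1))) / ((q : ℝ)⁻¹ - q) ^ 2 := by
  have h0 := q.2.1
  have hle := q.2.2.le
  have e1 : 0 ≤ (q : ℝ) ^ (-l + n) - (q : ℝ) ^ (l - n) :=
    sub_nonneg.2 (Real.rpow_le_rpow_of_exponent_ge h0 hle (by linarith))
  have e2 : 0 ≤ (q : ℝ) ^ (-l - n - 1) - (q : ℝ) ^ (l + n + 1) :=
    sub_nonneg.2 (Real.rpow_le_rpow_of_exponent_ge h0 hle (by linarith))
  unfold raiseCoeff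
  rw [div_mul_div_comm, Real.mul_self_sqrt (mul_nonneg e1 e2), ← sq]

lemma raiseCoeff_top (q : Param) (l : ℝ) : raiseCoeff q l l = 0 := by
  simp [raiseCoeff]

lemma raiseCoeff_bot (q : Param) (l : ℝ) : raiseCoeff q l (-l - 1) = 0 := by
  have : (q : ℝ) ^ (-l - (-l - 1) - 1) - (q : ℝ) ^ (l + (-l - 1) + 1) = 0 := by
    ring_nf
  unfold raiseCoeff
  rw [this]
  simp

lemma raiseCoeff_comm (q : Param) (l n : ℝ) (h1 : -l ≤ n) (h2 : n ≤ l)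
    (h3 : n = -l ∨ -l ≤ n - 1) :
    raiseCoeff q l n * raiseCoeff q l n - raiseCoeff q l (n - 1) * raiseCoeff q l (n - 1) =
      ((q : ℝ) - (q : ℝ)⁻¹)⁻¹ * ((q : ℝ) ^ (-n) * (q : ℝ) ^ (-n) - (q : ℝ) ^ n * (q : ℝ) ^ n) := by
  have h0 := q.2.1
  have hle := q.2.2
  have hd : 1 - (q : ℝ) ^ 2 ≠ 0 := by nlinarith
  have hd' : (q : ℝ) ^ 2 - 1 ≠ 0 := by nlinarith
  have hm : raiseCoeff q l (n - 1) * raiseCoeff q l (n - 1) =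
      (((q : ℝ) ^ (-l + (n - 1)) - (q : ℝ) ^ (l - (n - 1))) *
        ((q : ℝ) ^ (-l - (n - 1) - 1) - (q : ℝ) ^ (l + (n - 1) + 1))) / ((q : ℝ)⁻¹ - q) ^ 2 := by
    rcases h3 with h3 | h3
    · subst h3
      rw [raiseCoeff_bot]
      ring_nf
    · exact raiseCoeff_sq q l _ h3 (by linarith)
  rw [raiseCoeff_sq q l n h1 h2, hm]
  simp only [sub_eq_add_neg, neg_add, neg_neg, Real.rpow_add h0, Real.rpow_neg h0.le, Real.rpow_one]
  have ha : (q : ℝ) ^ l ≠ 0 := (Real.rpow_pos_of_pos h0 l).ne'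
  have hu : (q : ℝ) ^ n ≠ 0 := (Real.rpow_pos_of_pos h0 n).ne'
  have hq := h0.ne'
  have hd1 : (q : ℝ)⁻¹ + -(q : ℝ) ≠ 0 := by
    intro h; apply hd; field_simp at h; linarith
  have hd2 : (q : ℝ) + -(q : ℝ)⁻¹ ≠ 0 := by
    intro h; apply hd1; linarith
  have e1 : (q : ℝ)⁻¹ + -(q : ℝ) = (1 - (q : ℝ) ^ 2) / q := by field_simp; ring
  have e2 : (q : ℝ) + -(q : ℝ)⁻¹ = -((1 - (q : ℝ) ^ 2) / q) := by field_simp; ring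
  rw [e1, e2]
  generalize (q : ℝ) ^ l = a at *
  generalize (q : ℝ) ^ n = u at *
  generalize (q : ℝ) = p at *
  field_simp
  ring

lemma weight_succ (N k : ℕ) : weight N (k + 1) = weight N k + 1 := by
  simp [weight]; ring

lemma spinRepGen_mul_C_B (q : Param) (N : ℕ) :
    spinRepGen q N .C * spinRepGen q N .B = Matrix.diagonal fun k : Fin (N + 1) ↦
      ((raiseCoeff q (spin N) (weight N k - 1) * raiseCoeff q (spin N) (weight N k - 1) : ℝ) : ℂ) := by
  ext i k
  rw [Matrix.mul_apply, Matrix.diagonal_apply]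
  simp only [spinRepGen, Matrix.of_apply]
  by_cases hik : i = k
  · subst hik
    rw [if_pos rfl]
    rcases Nat.eq_zero_or_pos (i : ℕ) with hi | hi
    · have : weight N i - 1 = -spin N - 1 := by rw [hi]; simp [weight]
      rw [this, raiseCoeff_bot]
      rw [Finset.sum_eq_zero]
      · simp
      · intro p _
        rw [if_neg (by omega), zero_mul]
    · have hlt : (i : ℕ) - 1 < N + 1 := by omega
      rw [Finset.sum_eq_single (⟨(i : ℕ) - 1, hlt⟩ : Fin (N + 1))]
      · have hw : weight N ((i : ℕ) - 1) = weight N i - 1 := by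
          have := weight_succ N ((i : ℕ) - 1)
          rw [Nat.sub_add_cancel hi] at this
          linarith
        rw [if_pos (by simp; omega), if_pos (by simp; omega), lowerCoeff_eq]
        simp only [hw]
        push_cast
        rfl
      · intro p _ hp
        rw [if_neg (fun h ↦ hp (by ext; simp; omega)), zero_mul]
      · simp
  · rw [if_neg hik]
    apply Finset.sum_eq_zero
    intro p _
    by_cases h : (i : ℕ) = p + 1
    · rw [if_pos h, if_neg (fun h' ↦ hik (by ext; omega)), mul_zero]
    · rw [if_neg h, zero_mul]

lemma spinRepGen_mul_B_C (q : Param) (N : ℕ) :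
    spinRepGen q N .B * spinRepGen q N .C = Matrix.diagonal fun k : Fin (N + 1) ↦
      ((raiseCoeff q (spin N) (weight N k) * raiseCoeff q (spin N) (weight N k) : ℝ) : ℂ) := by
  ext i k
  rw [Matrix.mul_apply, Matrix.diagonal_apply]
  simp only [spinRepGen, Matrix.of_apply]
  by_cases hik : i = k
  · subst hik
    rw [if_pos rfl]
    rcases Nat.lt_or_ge (i : ℕ) N with hi | hi
    · rw [Finset.sum_eq_single (⟨(i : ℕ) + 1, by omega⟩ : Fin (N + 1))]
      · rw [if_pos rfl, if_pos rfl, lowerCoeff_eq]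
        simp only [weight_succ, add_sub_cancel_right]
        push_cast
        rfl
      · intro p _ hp
        rw [if_neg (fun h ↦ hp (by ext; simp; omega)), zero_mul]
      · simp
    · have hN : (i : ℕ) = N := by omega
      have : weight N i = spin N := by rw [hN]; simp [weight, spin]; ring
      rw [this, raiseCoeff_top]
      rw [Finset.sum_eq_zero]
      · simp
      · intro p _
        rw [if_neg (by omega), zero_mul]
  · rw [if_neg hik]
    apply Finset.sum_eq_zero
    intro p _
    by_cases h : (i : ℕ) + 1 = p
    · rw [if_pos h, if_neg (fun h' ↦ hik (by ext; omega)), mul_zero]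
    · rw [if_neg h, zero_mul]

/-- The irreducible representation `t^l`, `l = N / 2`, of `U_q(su(2))`. -/
def spinRep (q : Param) (N : ℕ) : Uq q →ₐ[ℂ] Matrix (Fin (N + 1)) (Fin (N + 1)) ℂ := by
  refine Uq.lift (spinRepGen q N) ?_ ?_ ?_ ?_ ?_
  · simp only [spinRepGen, Matrix.diagonal_mul_diagonal, ← qpow_add]
    simp [qpow]
  · simp only [spinRepGen, Matrix.diagonal_mul_diagonal, ← qpow_add]
    simp [qpow]
  · ext i k
    simp only [spinRepGen, Matrix.diagonal_mul, Matrix.smul_apply, Matrix.mul_diagonal,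
      Matrix.of_apply, smul_eq_mul]
    split_ifs with h
    · rw [← h, weight_succ, ← qpow_one, neg_add, qpow_add, qpow_neg q 1]
      have := qpow_ne_zero q 1
      field_simp
    · simp
  · ext i k
    simp only [spinRepGen, Matrix.diagonal_mul, Matrix.smul_apply, Matrix.mul_diagonal,
      Matrix.of_apply, smul_eq_mul]
    split_ifs with h
    · rw [h, weight_succ, ← qpow_one, neg_add, qpow_add, qpow_neg q 1]
      ring
    · simp
  · rw [spinRepGen_mul_C_B, spinRepGen_mul_B_C]
    simp only [spinRepGen, Matrix.diagonal_mul_diagonal, Matrix.diagonal_sub,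
      ← Matrix.diagonal_smul]
    congr 1
    funext k
    have hk : (k : ℕ) ≤ N := by omega
    have hk' : ((k : ℕ) : ℝ) ≤ N := by exact_mod_cast hk
    have := raiseCoeff_comm q (spin N) (weight N k)
      (by simp [weight]) (by simp only [weight, spin]; linarith)
      (by
        rcases Nat.eq_zero_or_pos (k : ℕ) with h | h
        · left; rw [h]; simp [weight]
        · right
          have : (1 : ℝ) ≤ ((k : ℕ) : ℝ) := by exact_mod_cast h
          simp only [weight]; linarith)
    rw [← Complex.ofReal_sub, this]
    simp [qpow, qc]

/-! ### The eigenvectors of `t^l(X_σ A)` -/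

/-- The `q`-shifted factorial `(a; p)_k`. -/
def qPoch (a p : ℝ) (k : ℕ) : ℝ := ∏ i ∈ Finset.range k, (1 - a * p ^ i)

/-- The `q`-binomial coefficient `[n, k]_p = (p^n; p⁻¹)_k / (p; p)_k`. -/
def qBinom (p : ℝ) (n k : ℕ) : ℝ := qPoch (p ^ n) p⁻¹ k / qPoch p p k

/-- The dual `q`-Krawtchouk polynomial `R_n` of base `p` with parameters `p^s`, `M`, at the point
`p^{-x} - p^{x-M-s}`, which is the terminating series
`₃φ₂(p^{-n}, p^{-x}, -p^{x-M-s}; p^{-M}, 0; p, p)`. -/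
def dualKrawtchouk (p s : ℝ) (M n x : ℕ) : ℝ :=
  ∑ k ∈ Finset.range (n + 1),
    (qPoch (p ^ (-(n : ℝ))) p k * qPoch (p ^ (-(x : ℝ))) p k * qPoch (-p ^ ((x : ℝ) - M - s)) p k) /
      (qPoch (p ^ (-(M : ℝ))) p k * qPoch 0 p k * qPoch p p k) * p ^ k

/-- The constant `C^{l,j}(σ)`, with `l = N / 2` and `j = k - l`. -/
def normConst (q : Param) (N k : ℕ) (σ : ℝ) : ℝ :=
  (q : ℝ) ^ k * √(qBinom ((q : ℝ) ^ 2) N (N - k)) *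
    √((1 + (q : ℝ) ^ (-4 * weight N k - 2 * σ)) / (1 + (q : ℝ) ^ (-2 * σ))) *
    (√(qPoch (-(q : ℝ) ^ (2 - 2 * σ)) ((q : ℝ) ^ 2) (N - k) *
      qPoch (-(q : ℝ) ^ (2 + 2 * σ)) ((q : ℝ) ^ 2) k))⁻¹

/-- The eigenvector `v^{l,j}(σ)`, with `l = N / 2` and `j = k - l`; its component along `e_n` is
stored at the index `r = l + n`. -/
def eigenVec (q : Param) (N k : ℕ) (σ : ℝ) : Fin (N + 1) → ℂ := fun r ↦
  ((normConst q N k σ : ℝ) : ℂ) * Complex.I ^ (-((N - r : ℕ) : ℤ)) *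
    (((q : ℝ) ^ (σ * (N - r : ℕ)) * (q : ℝ) ^ ((1 / 2 : ℝ) * (N - r : ℕ) * ((N - r : ℕ) - 1)) *
      √(qPoch ((q : ℝ) ^ (2 * N)) ((q : ℝ) ^ 2)⁻¹ (N - r) /
        qPoch ((q : ℝ) ^ 2) ((q : ℝ) ^ 2) (N - r)) *
      dualKrawtchouk ((q : ℝ) ^ 2) σ N (N - r) (N - k) : ℝ) : ℂ)

/-! ### Generalised matrix elements -/

/-- The linear functional `X ↦ ⟨t^l(X) v^{l,j}(σ), v^{l,i}(τ)⟩` on `U_q(su(2))`, with `l = N / 2`,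
`i = ki - l`, `j = kj - l`. -/
def genMatFunctional (q : Param) (N ki kj : ℕ) (τ σ : ℝ) : Uq q → ℂ := fun X ↦
  star (eigenVec q N ki τ) ⬝ᵥ (spinRep q N X *ᵥ eigenVec q N kj σ)

/-- `a ∈ A_q(SU(2))` is the generalised matrix element `a^l_{i,j}(τ,σ)`. -/
def IsGenMatElt (q : Param) (N ki kj : ℕ) (τ σ : ℝ) (a : Aq q) : Prop :=
  ∀ X : Uq q, pairing q X a = genMatFunctional q N ki kj τ σ X

/-- The element `γ_{τ,σ}`. -/
def gammaElt (q : Param) (τ σ : ℝ) : Aq q :=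
  (-qpow q (τ + 1 / 2)) • Aq.gen q .α + (Complex.I * qpow q (τ + σ - 1 / 2)) • Aq.gen q .β +
    (Complex.I * qpow q (1 / 2)) • Aq.gen q .γ + qpow q (σ - 1 / 2) • Aq.gen q .δ

/-- The element `δ_{τ,σ}`. -/
def deltaElt (q : Param) (τ σ : ℝ) : Aq q :=
  qpow q (τ + σ + 1 / 2) • Aq.gen q .α + (Complex.I * qpow q (τ - 1 / 2)) • Aq.gen q .β -
    (Complex.I * qpow q (σ + 1 / 2)) • Aq.gen q .γ + qpow q (-(1 / 2)) • Aq.gen q .δ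

/-- The constant `E^l_m(τ,σ)`, with `l = N / 2` and `m = k - l`. -/
def extremalConst (q : Param) (N k : ℕ) (τ σ : ℝ) : ℝ :=
  normConst q N k σ * normConst q N N τ * (q : ℝ) ^ (σ * (weight N k - spin N)) *
    (q : ℝ) ^ ((1 / 2 : ℝ) * (spin N - weight N k) * (spin N - weight N k - 1))

end QSU2

end

/-! Realise the spin `l = N / 2` representation on polynomials in one variable, with `X ^ n`
proportional to `e_{l-n}`. Both vectors in the matrix element then become explicit. For the extremal
index the series in `v^{l,l}(τ)` collapses to 1, and the inner product with this vector is
`C^{l,l}(τ)` times evaluation at the point `i q^{τ+(N-1)/2}` (`star_eigenVec_dotProduct`). The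
vector `t(A) v^{l,m}(σ)` becomes a product of linear factors, because with `p = q²` the dual
q-Krawtchouk polynomials, weighted by q-binomials, signs and powers of `p`, are the coefficients of
`(-p^{-σ}t; p)_{l-m} (t; p)_{l+m}` (`coeff_genPoly`, `toPoly_eigenVec`).

The same data are built one factor at a time in the algebra. The coefficient matrices of `γ_{τ,σ}`
and `δ_{τ,σ}` have rank one, with the same left vector `(i q^τ, 1)`. Multiplying a spin `N / 2`
matrix element by such an element gives a matrix element of a tensor product, and `fusion` is an
intertwiner from that product to spin `(N + 1) / 2`. Evaluation at the new point composed with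
`fusion` splits as the vector `(i q^{τ+N}, 1)` times evaluation at the old point (`eval_fusion`). So
left multiplication by `γ_{τ+N,·}` or `δ_{τ+N,·}` keeps the row an evaluation, while the column is
dilated and gains one linear factor (`IsEvalElt.rankOne_mul`). With the second indices of the
statement, each `γ` extends the first q-shifted factorial and each `δ` the second; induction gives
`isEvalElt_prod`.

This is an identity of functionals. It becomes one in `A_q(SU(2))` because the pairing separates
points there (`pairingHom_injective`): after multiplication by a high power of `α` only monomials
`α^e β^j γ^k` remain, and their values on `C^k A^n B^j`, for all `n`, separate them. Existence comes
from the invertibility of `A`: the element sought is `D.b`, with `b` the product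
(`existsUnique_of_mul_A`). -/

open scoped TensorProduct Matrix

noncomputable section

namespace QSU2

/-! ### Translations on the convolution algebra of functionals -/

/-- The convolution algebra of linear functionals on `U_q(su(2))`. -/
abbrev Dual (q : Param) : Type := WithConv (Uq q →ₗ[ℂ] ℂ)

/-- Evaluation of a functional. -/
def ev {q : Param} (X : Uq q) : Dual q →ₗ[ℂ] ℂ where
  toFun f := f.ofConv X
  map_add' _ _ := rfl
  map_smul' _ _ := rfl

/-- The convolution product evaluated on a tensor. -/
def evTensor {q : Param} (f g : Dual q) : Uq q ⊗[ℂ] Uq q →ₗ[ℂ] ℂ :=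
  LinearMap.mul' ℂ ℂ ∘ₗ TensorProduct.map f.ofConv g.ofConv

@[simp] lemma evTensor_tmul {q : Param} (f g : Dual q) (X Y : Uq q) :
    evTensor f g (X ⊗ₜ Y) = ev X f * ev Y g := rfl

lemma ev_mul {q : Param} (X : Uq q) (f g : Dual q) :
    ev X (f * g) = evTensor f g (Uq.comulHom q X) := rfl

lemma ev_one {q : Param} (X : Uq q) : ev X (1 : Dual q) = Uq.counitHom q X := rfl

lemma Dual.ext_ev {q : Param} {f g : Dual q} (h : ∀ X, ev X f = ev X g) : f = g := by
  apply WithConv.ext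
  ext X
  exact h X

lemma pairing_eq_ev (q : Param) (X : Uq q) (ξ : Aq q) :
    pairing q X ξ = ev X (pairingHom q ξ) := rfl

/-- Right translation of functionals, `f ↦ f(· Y)`. -/
def rightTr {q : Param} (Y : Uq q) : Dual q →ₗ[ℂ] Dual q where
  toFun f := WithConv.toConv (f.ofConv ∘ₗ LinearMap.mulRight ℂ Y)
  map_add' _ _ := rfl
  map_smul' _ _ := rfl

/-- Left translation of functionals, `f ↦ f(Y ·)`. -/
def leftTr {q : Param} (Y : Uq q) : Dual q →ₗ[ℂ] Dual q where
  toFun f := WithConv.toConv (f.ofConv ∘ₗ LinearMap.mulLeft ℂ Y)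
  map_add' _ _ := rfl
  map_smul' _ _ := rfl

@[simp] lemma ev_rightTr {q : Param} (X Y : Uq q) (f : Dual q) :
    ev X (rightTr Y f) = ev (X * Y) f := rfl

@[simp] lemma ev_leftTr {q : Param} (X Y : Uq q) (f : Dual q) :
    ev X (leftTr Y f) = ev (Y * X) f := rfl

lemma evTensor_mul_right {q : Param} (f g : Dual q) (t : Uq q ⊗[ℂ] Uq q) (Y Z : Uq q) :
    evTensor f g (t * (Y ⊗ₜ Z)) = evTensor (rightTr Y f) (rightTr Z g) t := by
  induction t using TensorProduct.induction_on with
  | zero => simp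
  | tmul x y => simp [Algebra.TensorProduct.tmul_mul_tmul]
  | add x y hx hy => rw [add_mul, map_add, map_add, hx, hy]

lemma evTensor_mul_left {q : Param} (f g : Dual q) (t : Uq q ⊗[ℂ] Uq q) (Y Z : Uq q) :
    evTensor f g ((Y ⊗ₜ Z) * t) = evTensor (leftTr Y f) (leftTr Z g) t := by
  induction t using TensorProduct.induction_on with
  | zero => simp
  | tmul x y => simp [Algebra.TensorProduct.tmul_mul_tmul]
  | add x y hx hy => rw [mul_add, map_add, map_add, hx, hy]

lemma Uq.comulHom_gen (q : Param) (x : UGen) :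
    Uq.comulHom q (Uq.gen q x) = Uq.comulGen q x := by
  simp [Uq.comulHom]

/-- An element is group-like. -/
structure IsGrp (q : Param) (g : Uq q) : Prop where
  comul : Uq.comulHom q g = g ⊗ₜ g
  counit : Uq.counitHom q g = 1

lemma isGrp_A (q : Param) : IsGrp q (Uq.gen q .A) :=
  ⟨Uq.comulHom_gen q .A, by simp [Uq.counitHom]⟩

lemma isGrp_D (q : Param) : IsGrp q (Uq.gen q .D) :=
  ⟨Uq.comulHom_gen q .D, by simp [Uq.counitHom]⟩

/-- Since `Δ(g) = g ⊗ g`, translating a convolution product by `g` translates each factor. -/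
lemma IsGrp.rightTr_mul {q : Param} {g : Uq q} (h : IsGrp q g) (f f' : Dual q) :
    rightTr g (f * f') = rightTr g f * rightTr g f' :=
  Dual.ext_ev fun X ↦ by
    rw [ev_rightTr, ev_mul, ev_mul, map_mul, h.comul, evTensor_mul_right]

lemma IsGrp.leftTr_mul {q : Param} {g : Uq q} (h : IsGrp q g) (f f' : Dual q) :
    leftTr g (f * f') = leftTr g f * leftTr g f' :=
  Dual.ext_ev fun X ↦ by
    rw [ev_leftTr, ev_mul, ev_mul, map_mul, h.comul, evTensor_mul_left]

lemma IsGrp.rightTr_one {q : Param} {g : Uq q} (h : IsGrp q g) :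
    rightTr g (1 : Dual q) = 1 :=
  Dual.ext_ev fun X ↦ by
    rw [ev_rightTr, ev_one, ev_one, map_mul, h.counit, mul_one]

lemma IsGrp.leftTr_one {q : Param} {g : Uq q} (h : IsGrp q g) :
    leftTr g (1 : Dual q) = 1 :=
  Dual.ext_ev fun X ↦ by
    rw [ev_leftTr, ev_one, ev_one, map_mul, h.counit, one_mul]

/-- `Δ(B) = A ⊗ B + B ⊗ D` makes right translation by `B` a skew derivation. Together with the
analogous rule for left translation by `C`, it allows monomials to be evaluated on `C^k A^n B^j` by
stripping off one letter at a time. -/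
lemma rightTr_B_mul {q : Param} (f g : Dual q) :
    rightTr (Uq.gen q .B) (f * g) = rightTr (Uq.gen q .A) f * rightTr (Uq.gen q .B) g +
      rightTr (Uq.gen q .B) f * rightTr (Uq.gen q .D) g :=
  Dual.ext_ev fun X ↦ by
    rw [ev_rightTr, map_add, ev_mul, ev_mul, ev_mul, map_mul, Uq.comulHom_gen, Uq.comulGen,
      mul_add, map_add, evTensor_mul_right, evTensor_mul_right]

lemma leftTr_C_mul {q : Param} (f g : Dual q) :
    leftTr (Uq.gen q .C) (f * g) = leftTr (Uq.gen q .A) f * leftTr (Uq.gen q .C) g +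
      leftTr (Uq.gen q .C) f * leftTr (Uq.gen q .D) g :=
  Dual.ext_ev fun X ↦ by
    rw [ev_leftTr, map_add, ev_mul, ev_mul, ev_mul, map_mul, Uq.comulHom_gen, Uq.comulGen,
      add_mul, map_add, evTensor_mul_left, evTensor_mul_left]

lemma rightTr_B_one {q : Param} : rightTr (Uq.gen q .B) (1 : Dual q) = 0 :=
  Dual.ext_ev fun X ↦ by
    rw [ev_rightTr, ev_one, map_mul]; simp [Uq.counitHom]

lemma leftTr_C_one {q : Param} : leftTr (Uq.gen q .C) (1 : Dual q) = 0 :=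
  Dual.ext_ev fun X ↦ by
    rw [ev_leftTr, ev_one, map_mul]; simp [Uq.counitHom]

/-! ### Translates of the coefficients of the two-dimensional representation -/

lemma ev_coef (q : Param) (i j : Fin 2) (X : Uq q) : ev X (coef q i j) = funRep q X i j := rfl

lemma funRep_gen (q : Param) (x : UGen) : funRep q (Uq.gen q x) = funRepGen q x := by
  simp [funRep]

lemma rightTr_coef (q : Param) (x : UGen) (i j : Fin 2) :
    rightTr (Uq.gen q x) (coef q i j) =
      funRepGen q x 0 j • coef q i 0 + funRepGen q x 1 j • coef q i 1 :=
  Dual.ext_ev fun X ↦ by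
    rw [ev_rightTr, ev_coef, map_mul, funRep_gen, Matrix.mul_apply, Fin.sum_univ_two, map_add,
      map_smul, map_smul, ev_coef, ev_coef, smul_eq_mul, smul_eq_mul]
    ring

lemma leftTr_coef (q : Param) (x : UGen) (i j : Fin 2) :
    leftTr (Uq.gen q x) (coef q i j) =
      funRepGen q x i 0 • coef q 0 j + funRepGen q x i 1 • coef q 1 j :=
  Dual.ext_ev fun X ↦ by
    rw [ev_leftTr, ev_coef, map_mul, funRep_gen, Matrix.mul_apply, Fin.sum_univ_two, map_add,
      map_smul, map_smul, ev_coef, ev_coef, smul_eq_mul, smul_eq_mul]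

lemma pairingHom_gen (q : Param) (x : AGen) : pairingHom q (Aq.gen q x) = coefGen q x := by
  simp [pairingHom]

/-! ### The action of group-like elements on `A_q(SU(2))` -/

lemma Aq.induction {q : Param} {P : Aq q → Prop} (hc : ∀ c : ℂ, P (algebraMap ℂ _ c))
    (hg : ∀ x, P (gen q x)) (hadd : ∀ x y, P x → P y → P (x + y))
    (hmul : ∀ x y, P x → P y → P (x * y)) (x : Aq q) : P x := by
  obtain ⟨y, rfl⟩ : ∃ y, mk q y = x := RingQuot.mkAlgHom_surjective ℂ (ARel q) x
  induction y using FreeAlgebra.induction with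
  | grade0 r => rw [AlgHom.commutes]; exact hc r
  | grade1 x => exact hg x
  | mul a b ha hb => rw [map_mul]; exact hmul _ _ ha hb
  | add a b ha hb => rw [map_add]; exact hadd _ _ ha hb

lemma IsGrp.pairing_mul {q : Param} {g : Uq q} (h : IsGrp q g) (ξ η : Aq q) :
    pairing q g (ξ * η) = pairing q g ξ * pairing q g η := by
  rw [pairing_eq_ev, map_mul, ev_mul, h.comul]
  rfl

lemma IsGrp.leftAct_mul {q : Param} {g : Uq q} (h : IsGrp q g) (ξ η : Aq q) :
    leftAct q g (ξ * η) = leftAct q g ξ * leftAct q g η := by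
  simp only [leftAct, LinearMap.comp_apply, AlgHom.toLinearMap_apply, map_mul]
  generalize Aq.comulHom q ξ = s
  generalize Aq.comulHom q η = t
  induction s using TensorProduct.induction_on with
  | zero => simp
  | add x y hx hy => simp only [add_mul, map_add, hx, hy]
  | tmul a b =>
    induction t using TensorProduct.induction_on with
    | zero => simp
    | add x y hx hy => simp only [mul_add, map_add, hx, hy]
    | tmul c d => simp [h.pairing_mul, smul_smul, mul_comm]

lemma IsGrp.leftAct_algebraMap {q : Param} {g : Uq q} (h : IsGrp q g) (c : ℂ) :
    leftAct q g (algebraMap ℂ _ c) = algebraMap ℂ _ c := by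
  have h1 : pairing q g 1 = 1 := by
    rw [pairing_eq_ev, map_one, ev_one, h.counit]
  rw [Algebra.algebraMap_eq_smul_one, map_smul]
  simp [leftAct, Algebra.TensorProduct.one_def, h1]

lemma pairing_gen (q : Param) (X : Uq q) :
    pairing q X (Aq.gen q .α) = funRep q X 0 0 ∧ pairing q X (Aq.gen q .β) = funRep q X 0 1 ∧
    pairing q X (Aq.gen q .γ) = funRep q X 1 0 ∧ pairing q X (Aq.gen q .δ) = funRep q X 1 1 := by
  simp only [pairing_eq_ev, pairingHom_gen, coefGen, ev_coef, and_self]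

/-- On generators `Δ` is matrix multiplication, so the claim is the multiplicativity of `funRep`;
here `Y` need not be group-like. -/
lemma leftAct_gen (q : Param) (Y : Uq q) (x : AGen) :
    pairingHom q (leftAct q Y (Aq.gen q x)) = rightTr Y (pairingHom q (Aq.gen q x)) := by
  obtain ⟨h1, h2, h3, h4⟩ := pairing_gen q Y
  refine Dual.ext_ev fun X ↦ ?_
  rw [ev_rightTr, ← pairing_eq_ev, ← pairing_eq_ev]
  obtain ⟨k1, k2, k3, k4⟩ := pairing_gen q X
  obtain ⟨j1, j2, j3, j4⟩ := pairing_gen q (X * Y)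
  cases x <;>
    simp [leftAct, Aq.comulHom, Aq.comulGen, j1, j2, j3, j4, k1, k2, k3, k4, h1, h2, h3, h4,
      Matrix.mul_apply, mul_comm]

/-- For group-like `g` both sides are multiplicative in `ξ`, which reduces the claim to generators.
Only `g = A` and `g = D` are needed. -/
lemma IsGrp.pairingHom_leftAct {q : Param} {g : Uq q} (h : IsGrp q g) (ξ : Aq q) :
    pairingHom q (leftAct q g ξ) = rightTr g (pairingHom q ξ) := by
  induction ξ using Aq.induction with
  | hc c =>
    rw [h.leftAct_algebraMap, Algebra.algebraMap_eq_smul_one, map_smul, map_smul, map_one,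
      h.rightTr_one]
  | hg x => exact leftAct_gen q g x
  | hadd x y hx hy => simp only [map_add, hx, hy]
  | hmul x y hx hy => rw [h.leftAct_mul, map_mul, map_mul, h.rightTr_mul, hx, hy]

lemma IsGrp.pairing_leftAct {q : Param} {g : Uq q} (h : IsGrp q g) (X : Uq q) (ξ : Aq q) :
    pairing q X (leftAct q g ξ) = pairing q (X * g) ξ := by
  rw [pairing_eq_ev, h.pairingHom_leftAct, ev_rightTr, pairing_eq_ev]

/-! ### Nondegeneracy of the pairing -/

section Monomials

variable (q : Param)

lemma qpow_pow (x : ℝ) (n : ℕ) : qpow q x ^ n = qpow q (n * x) := by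
  unfold qpow
  rw [← Complex.ofReal_pow, ← Real.rpow_natCast, ← Real.rpow_mul q.2.1.le, mul_comm]

lemma qpow_zero : qpow q 0 = 1 := by simp [qpow]

lemma coef_ab : coef q 0 0 * coef q 0 1 = qc q • (coef q 0 1 * coef q 0 0) := by
  simpa only [map_mul, map_smul, pairingHom_gen, coefGen] using congrArg (pairingHom q) (Aq.αβ q)

lemma coef_ac : coef q 0 0 * coef q 1 0 = qc q • (coef q 1 0 * coef q 0 0) := by
  simpa only [map_mul, map_smul, pairingHom_gen, coefGen] using congrArg (pairingHom q) (Aq.αγ q)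

lemma coef_ba : coef q 0 1 * coef q 0 0 = (qc q)⁻¹ • (coef q 0 0 * coef q 0 1) := by
  rw [coef_ab, smul_smul, inv_mul_cancel₀ (qc_ne_zero q), one_smul]

lemma coef_ca : coef q 1 0 * coef q 0 0 = (qc q)⁻¹ • (coef q 0 0 * coef q 1 0) := by
  rw [coef_ac, smul_smul, inv_mul_cancel₀ (qc_ne_zero q), one_smul]

variable {q} in
lemma IsGrp.rightTr_pow {g : Uq q} (h : IsGrp q g) {f : Dual q} {s : ℂ}
    (hf : rightTr g f = s • f) (n : ℕ) : rightTr g (f ^ n) = s ^ n • f ^ n := by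
  induction n with
  | zero => simp [h.rightTr_one]
  | succ n ih => rw [pow_succ, h.rightTr_mul, ih, hf, smul_mul_smul_comm, pow_succ]

variable {q} in
lemma IsGrp.leftTr_pow {g : Uq q} (h : IsGrp q g) {f : Dual q} {s : ℂ}
    (hf : leftTr g f = s • f) (n : ℕ) : leftTr g (f ^ n) = s ^ n • f ^ n := by
  induction n with
  | zero => simp [h.leftTr_one]
  | succ n ih => rw [pow_succ, h.leftTr_mul, ih, hf, smul_mul_smul_comm, pow_succ]

lemma rightTr_A_a : rightTr (Uq.gen q .A) (coef q 0 0) = qpow q (1 / 2) • coef q 0 0 := by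
  simp [rightTr_coef, funRepGen]
lemma rightTr_A_b : rightTr (Uq.gen q .A) (coef q 0 1) = qpow q (-(1 / 2)) • coef q 0 1 := by
  simp [rightTr_coef, funRepGen]
lemma rightTr_A_c : rightTr (Uq.gen q .A) (coef q 1 0) = qpow q (1 / 2) • coef q 1 0 := by
  simp [rightTr_coef, funRepGen]
lemma rightTr_D_b : rightTr (Uq.gen q .D) (coef q 0 1) = qpow q (1 / 2) • coef q 0 1 := by
  simp [rightTr_coef, funRepGen]
lemma rightTr_D_c : rightTr (Uq.gen q .D) (coef q 1 0) = qpow q (-(1 / 2)) • coef q 1 0 := by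
  simp [rightTr_coef, funRepGen]
lemma rightTr_B_a : rightTr (Uq.gen q .B) (coef q 0 0) = 0 := by
  simp [rightTr_coef, funRepGen]
lemma rightTr_B_b : rightTr (Uq.gen q .B) (coef q 0 1) = coef q 0 0 := by
  simp [rightTr_coef, funRepGen]
lemma rightTr_B_c : rightTr (Uq.gen q .B) (coef q 1 0) = 0 := by
  simp [rightTr_coef, funRepGen]
lemma leftTr_A_a : leftTr (Uq.gen q .A) (coef q 0 0) = qpow q (1 / 2) • coef q 0 0 := by
  simp [leftTr_coef, funRepGen]
lemma leftTr_A_b : leftTr (Uq.gen q .A) (coef q 0 1) = qpow q (1 / 2) • coef q 0 1 := by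
  simp [leftTr_coef, funRepGen]
lemma leftTr_A_c : leftTr (Uq.gen q .A) (coef q 1 0) = qpow q (-(1 / 2)) • coef q 1 0 := by
  simp [leftTr_coef, funRepGen]
lemma leftTr_D_c : leftTr (Uq.gen q .D) (coef q 1 0) = qpow q (1 / 2) • coef q 1 0 := by
  simp [leftTr_coef, funRepGen]
lemma leftTr_C_a : leftTr (Uq.gen q .C) (coef q 0 0) = 0 := by
  simp [leftTr_coef, funRepGen]
lemma leftTr_C_b : leftTr (Uq.gen q .C) (coef q 0 1) = 0 := by
  simp [leftTr_coef, funRepGen]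
lemma leftTr_C_c : leftTr (Uq.gen q .C) (coef q 1 0) = coef q 0 0 := by
  simp [leftTr_coef, funRepGen]

variable {q} in
/-- If `B` annihilates `f` and `A` scales it, `B` acts on `f ^ n * g` through `g` only. -/
lemma rightTr_B_pow_mul {f : Dual q} {s : ℂ} (hB : rightTr (Uq.gen q .B) f = 0)
    (hA : rightTr (Uq.gen q .A) f = s • f) (n : ℕ) (g : Dual q) :
    rightTr (Uq.gen q .B) (f ^ n * g) = s ^ n • (f ^ n * rightTr (Uq.gen q .B) g) := by
  induction n with
  | zero => simp
  | succ n ih =>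
    rw [pow_succ', mul_assoc, rightTr_B_mul, hB, hA, ih, zero_mul, add_zero, smul_mul_smul_comm,
      mul_assoc, pow_succ']

variable {q} in
/-- If `C` annihilates `f` and `A` scales it, `C` acts on `f ^ n * g` through `g` only. -/
lemma leftTr_C_pow_mul {f : Dual q} {s : ℂ} (hC : leftTr (Uq.gen q .C) f = 0)
    (hA : leftTr (Uq.gen q .A) f = s • f) (n : ℕ) (g : Dual q) :
    leftTr (Uq.gen q .C) (f ^ n * g) = s ^ n • (f ^ n * leftTr (Uq.gen q .C) g) := by
  induction n with
  | zero => simp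
  | succ n ih =>
    rw [pow_succ', mul_assoc, leftTr_C_mul, hC, hA, ih, zero_mul, add_zero, smul_mul_smul_comm,
      mul_assoc, pow_succ']

lemma rightTr_B_c_pow (k : ℕ) : rightTr (Uq.gen q .B) (coef q 1 0 ^ k) = 0 := by
  have := rightTr_B_pow_mul (rightTr_B_c q) (rightTr_A_c q) k 1
  simpa [rightTr_B_one] using this

/-- The skew Leibniz rule gives one term for each factor `β`; after reordering with `βα = q⁻¹αβ` all
of them are positive multiples of the same monomial, so nothing cancels. Only the nonvanishing of
the total matters later. -/
lemma rightTr_B_bc (j k : ℕ) : ∃ r : ℝ, 0 < r ∧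
    rightTr (Uq.gen q .B) (coef q 0 1 ^ (j + 1) * coef q 1 0 ^ k) =
      (r : ℂ) • (coef q 0 0 * (coef q 0 1 ^ j * coef q 1 0 ^ k)) := by
  have h0 := q.2.1
  have hD (i : ℕ) : rightTr (Uq.gen q .D) (coef q 0 1 ^ i * coef q 1 0 ^ k) =
      (qpow q (1 / 2) ^ i * qpow q (-(1 / 2)) ^ k) • (coef q 0 1 ^ i * coef q 1 0 ^ k) := by
    rw [(isGrp_D q).rightTr_mul, (isGrp_D q).rightTr_pow (rightTr_D_b q),
      (isGrp_D q).rightTr_pow (rightTr_D_c q), smul_mul_smul_comm]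
  induction j with
  | zero =>
    refine ⟨((q : ℝ) ^ (-(1 / 2) : ℝ)) ^ k, by positivity, ?_⟩
    rw [zero_add, pow_one, rightTr_B_mul, rightTr_B_c_pow, rightTr_B_b, mul_zero, zero_add,
      (isGrp_D q).rightTr_pow (rightTr_D_c q), mul_smul_comm]
    simp [qpow]
  | succ j ih =>
    obtain ⟨r, hr, ih⟩ := ih
    refine ⟨(q : ℝ) ^ (-(1 / 2) : ℝ) * r * (q : ℝ)⁻¹ +
      ((q : ℝ) ^ (1 / 2 : ℝ)) ^ (j + 1) * ((q : ℝ) ^ (-(1 / 2) : ℝ)) ^ k, by positivity, ?_⟩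
    rw [pow_succ' _ (j + 1), mul_assoc, rightTr_B_mul, ih, rightTr_A_b, rightTr_B_b, hD,
      smul_mul_smul_comm, mul_smul_comm, ← mul_assoc (coef q 0 1), coef_ba, smul_mul_assoc,
      smul_smul, mul_assoc (coef q 0 0), ← mul_assoc (coef q 0 1) (coef q 0 1 ^ j), ← pow_succ',
      ← add_smul]
    congr 1
    simp [qpow, qc]

lemma leftTr_C_c_pow (k : ℕ) : ∃ r : ℝ, 0 < r ∧
    leftTr (Uq.gen q .C) (coef q 1 0 ^ (k + 1)) =
      (r : ℂ) • (coef q 0 0 * coef q 1 0 ^ k) := by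
  have h0 := q.2.1
  induction k with
  | zero => exact ⟨1, one_pos, by simp [leftTr_C_c]⟩
  | succ k ih =>
    obtain ⟨r, hr, ih⟩ := ih
    refine ⟨(q : ℝ) ^ (-(1 / 2) : ℝ) * r * (q : ℝ)⁻¹ + ((q : ℝ) ^ (1 / 2 : ℝ)) ^ (k + 1),
      by positivity, ?_⟩
    rw [pow_succ' _ (k + 1), leftTr_C_mul, ih, leftTr_A_c, leftTr_C_c,
      (isGrp_D q).leftTr_pow (leftTr_D_c q), smul_mul_smul_comm, mul_smul_comm,
      ← mul_assoc (coef q 1 0), coef_ca, smul_mul_assoc,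
      smul_smul, mul_assoc (coef q 0 0), ← pow_succ', ← add_smul]
    congr 1
    simp [qpow, qc]

/-- The functional given by a normally ordered monomial. -/
def mono (e j k : ℕ) : Dual q := coef q 0 0 ^ e * (coef q 0 1 ^ j * coef q 1 0 ^ k)

lemma rightTr_B_mono_zero (e k : ℕ) : rightTr (Uq.gen q .B) (mono q e 0 k) = 0 := by
  rw [mono, pow_zero, one_mul, rightTr_B_pow_mul (rightTr_B_a q) (rightTr_A_a q), rightTr_B_c_pow,
    mul_zero, smul_zero]

/-- Translation by `B` trades a `β` for an `α`, so the total degree is preserved. -/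
lemma rightTr_B_mono_succ (e j k : ℕ) : ∃ r : ℂ, r ≠ 0 ∧
    rightTr (Uq.gen q .B) (mono q e (j + 1) k) = r • mono q (e + 1) j k := by
  obtain ⟨r, hr, h⟩ := rightTr_B_bc q j k
  refine ⟨qpow q (1 / 2) ^ e * r,
    mul_ne_zero (pow_ne_zero _ (qpow_ne_zero _ _)) (by exact_mod_cast hr.ne'), ?_⟩
  rw [mono, rightTr_B_pow_mul (rightTr_B_a q) (rightTr_A_a q), h, mul_smul_comm, smul_smul,
    ← mul_assoc, ← pow_succ, mono]

lemma b_pow_mul_a (j : ℕ) : coef q 0 1 ^ j * coef q 0 0 =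
    ((qc q)⁻¹) ^ j • (coef q 0 0 * coef q 0 1 ^ j) := by
  induction j with
  | zero => simp
  | succ j ih =>
    rw [pow_succ', mul_assoc, ih, mul_smul_comm, ← mul_assoc, coef_ba, smul_mul_assoc, smul_smul,
      mul_assoc, pow_succ]

lemma leftTr_C_mono_zero (e j : ℕ) : leftTr (Uq.gen q .C) (mono q e j 0) = 0 := by
  rw [mono, leftTr_C_pow_mul (leftTr_C_a q) (leftTr_A_a q),
    leftTr_C_pow_mul (leftTr_C_b q) (leftTr_A_b q), pow_zero, leftTr_C_one]
  simp

/-- The mirror image on the left: `C` trades a `γ` for an `α`. It passes over the powers of `α` and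
`β`, which it annihilates, at the cost of powers of `q^{1/2}`. -/
lemma leftTr_C_mono_succ (e j k : ℕ) : ∃ r : ℂ, r ≠ 0 ∧
    leftTr (Uq.gen q .C) (mono q e j (k + 1)) = r • mono q (e + 1) j k := by
  obtain ⟨r, hr, h⟩ := leftTr_C_c_pow q k
  refine ⟨qpow q (1 / 2) ^ e * (qpow q (1 / 2) ^ j * (r * (qc q)⁻¹ ^ j)), ?_, ?_⟩
  · have := qpow_ne_zero q (1 / 2)
    have := qc_ne_zero q
    have : (r : ℂ) ≠ 0 := by exact_mod_cast hr.ne'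
    positivity
  rw [mono, leftTr_C_pow_mul (leftTr_C_a q) (leftTr_A_a q),
    leftTr_C_pow_mul (leftTr_C_b q) (leftTr_A_b q), h,
    mul_smul_comm (r : ℂ), ← mul_assoc (coef q 0 1 ^ j), b_pow_mul_a, smul_mul_assoc]
  simp only [mul_smul_comm, smul_smul]
  rw [mono, pow_succ]
  simp only [mul_assoc]

lemma rightTr_A_mono (e j k : ℕ) : rightTr (Uq.gen q .A) (mono q e j k) =
    (qpow q (1 / 2) ^ e * (qpow q (-(1 / 2)) ^ j * qpow q (1 / 2) ^ k)) • mono q e j k := by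
  have h := isGrp_A q
  rw [mono, h.rightTr_mul, h.rightTr_mul, h.rightTr_pow (rightTr_A_a q),
    h.rightTr_pow (rightTr_A_b q), h.rightTr_pow (rightTr_A_c q), smul_mul_smul_comm,
    smul_mul_smul_comm]

/-- The unit is group-like, so evaluation at it is a character. -/
lemma ev_one_mul (f g : Dual q) : ev 1 (f * g) = ev 1 f * ev 1 g := by
  rw [ev_mul, map_one]
  rfl

lemma ev_one_pow (f : Dual q) (n : ℕ) : ev 1 (f ^ n) = ev 1 f ^ n := by
  induction n with
  | zero => rw [pow_zero, ev_one, map_one, pow_zero]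
  | succ n ih => rw [pow_succ, ev_one_mul, ih, pow_succ]

lemma ev_one_mono (e j k : ℕ) : ev 1 (mono q e j k) = if j = 0 ∧ k = 0 then 1 else 0 := by
  simp only [mono, ev_one_mul, ev_one_pow, ev_coef, map_one]
  rcases j with _ | j <;> rcases k with _ | k <;> simp

/-- The values of a monomial on `C ^ k' * A ^ n * B ^ j'`. -/
lemma ev_mono (j' k' e j k : ℕ) : ∃ r : ℂ, r ≠ 0 ∧ ∀ n : ℕ,
    ev (Uq.gen q .C ^ k' * Uq.gen q .A ^ n * Uq.gen q .B ^ j') (mono q e j k) =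
      if j = j' ∧ k = k' then r * qpow q ((e + j + k) / 2) ^ n else 0 := by
  -- Each `B` is absorbed as a right translation and, below, each `C` as a left translation. What
  -- remains is a power of `A`, for which monomials are eigenvectors.
  induction j' generalizing e j with
  | succ j' ih =>
    have hrec (n : ℕ) (f : Dual q) :
        ev (Uq.gen q .C ^ k' * Uq.gen q .A ^ n * Uq.gen q .B ^ (j' + 1)) f =
        ev (Uq.gen q .C ^ k' * Uq.gen q .A ^ n * Uq.gen q .B ^ j') (rightTr (Uq.gen q .B) f) := by
      rw [ev_rightTr, pow_succ, mul_assoc (_ * _)]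
    rcases j with _ | j
    -- The value is zero for every `n`, so any nonzero constant serves as witness.
    · refine ⟨1, one_ne_zero, fun n ↦ ?_⟩
      rw [hrec, rightTr_B_mono_zero, map_zero, if_neg (by omega)]
    · obtain ⟨r, hr, h⟩ := rightTr_B_mono_succ q e j k
      obtain ⟨s, hs, h'⟩ := ih (e + 1) j
      refine ⟨r * s, mul_ne_zero hr hs, fun n ↦ ?_⟩
      rw [hrec, h, map_smul, h', smul_eq_mul, mul_ite, mul_zero, ← mul_assoc]
      -- The total degree is unchanged, hence so is the eigenvalue of `A`.
      have : ((e + 1 : ℕ) + j + k : ℝ) = e + (j + 1 : ℕ) + k := by push_cast; ring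
      rw [this]
      simp only [add_left_inj]
  | zero =>
    induction k' generalizing k e with
    | succ k' ih =>
      have hrec (n : ℕ) (f : Dual q) :
          ev (Uq.gen q .C ^ (k' + 1) * Uq.gen q .A ^ n * Uq.gen q .B ^ 0) f =
          ev (Uq.gen q .C ^ k' * Uq.gen q .A ^ n * Uq.gen q .B ^ 0)
            (leftTr (Uq.gen q .C) f) := by
        rw [ev_leftTr, pow_succ', mul_assoc, mul_assoc, mul_assoc]
      rcases k with _ | k
      · refine ⟨1, one_ne_zero, fun n ↦ ?_⟩
        rw [hrec, leftTr_C_mono_zero, map_zero, if_neg (by omega)]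
      · obtain ⟨r, hr, h⟩ := leftTr_C_mono_succ q e j k
        obtain ⟨s, hs, h'⟩ := ih (k := k) (e := e + 1)
        refine ⟨r * s, mul_ne_zero hr hs, fun n ↦ ?_⟩
        rw [hrec, h, map_smul, h', smul_eq_mul, mul_ite, mul_zero, ← mul_assoc]
        have : ((e + 1 : ℕ) + j + k : ℝ) = e + j + (k + 1 : ℕ) := by push_cast; ring
        rw [this]
        simp only [add_left_inj]
    | zero =>
      refine ⟨1, one_ne_zero, fun n ↦ ?_⟩
      simp only [pow_zero, one_mul, mul_one]
      have key : ev (Uq.gen q .A ^ n) (mono q e j k) =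
          (qpow q (1 / 2) ^ e * (qpow q (-(1 / 2)) ^ j * qpow q (1 / 2) ^ k)) ^ n *
            ev 1 (mono q e j k) := by
        induction n with
        | zero => simp
        | succ n ih =>
          rw [pow_succ, ← ev_rightTr, rightTr_A_mono, map_smul, ih, smul_eq_mul]
          ring
      rw [key, ev_one_mono]
      by_cases h : j = 0 ∧ k = 0
      · rw [if_pos h, if_pos h, h.1, h.2, mul_one, qpow_pow]
        simp [div_eq_mul_inv]
      · rw [if_neg h, if_neg h, mul_zero]

end Monomials

/-! ### Normal ordering in `A_q(SU(2))` and separation of normally ordered elements -/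

section Nondegenerate

open Polynomial

/-- By linearity the hypothesis extends from powers to all polynomials; the one vanishing at every
node except `x i` isolates `v i`. -/
lemma eq_zero_of_sum_mul_pow_eq_zero {ι : Type*} [DecidableEq ι] (S : Finset ι) (v x : ι → ℂ)
    (hx : Set.InjOn x S) (h : ∀ n : ℕ, ∑ i ∈ S, v i * x i ^ n = 0) {i : ι} (hi : i ∈ S) :
    v i = 0 := by
  have hp (p : ℂ[X]) : ∑ i ∈ S, v i * p.eval (x i) = 0 := by
    induction p using Polynomial.induction_on' with
    | add p r hp hr => simp only [eval_add, mul_add, Finset.sum_add_distrib, hp, hr, add_zero]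
    | monomial n a =>
      have : ∑ i ∈ S, v i * (monomial n a).eval (x i) = a * ∑ i ∈ S, v i * x i ^ n := by
        rw [Finset.mul_sum]
        refine Finset.sum_congr rfl fun i _ ↦ ?_
        rw [eval_monomial]
        ring
      rw [this, h, mul_zero]
  have := hp (∏ j ∈ S.erase i, (X - C (x j)))
  rw [Finset.sum_eq_single_of_mem i hi] at this
  · refine (mul_eq_zero.1 this).resolve_right ?_
    rw [eval_prod]
    refine Finset.prod_ne_zero_iff.2 ?_
    intro j hj
    rw [Finset.mem_erase] at hj
    simpa [sub_eq_zero] using fun h' ↦ hj.1 (hx hj.2 hi h'.symm)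
  · intro j hj hji
    rw [eval_prod, Finset.prod_eq_zero (Finset.mem_erase.2 ⟨hji, hj⟩) (by simp), mul_zero]

variable (q : Param)

/-- Polynomials in `β` (outer variable) and `γ` (inner variable). -/
def polyBC : ℂ[X][X] →ₐ[ℂ] Aq q :=
  eval₂AlgHom (aeval (Aq.gen q .γ)) (Aq.gen q .β) fun f ↦ by
    have h : Commute (Aq.gen q .γ) (Aq.gen q .β) := (Aq.βγ q).symm
    induction f using Polynomial.induction_on' with
    | add f g hf hg => rw [map_add]; exact hf.add_left hg
    | monomial n a =>
      rw [aeval_monomial]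
      exact (Algebra.commute_algebraMap_left a _).mul_left (h.pow_left n)

lemma polyBC_X : polyBC q X = Aq.gen q .β := by simp [polyBC]

lemma polyBC_C_X : polyBC q (C X) = Aq.gen q .γ := by simp [polyBC]

lemma polyBC_monomial (j k : ℕ) (z : ℂ) :
    polyBC q (monomial j (monomial k z)) = z • (Aq.gen q .β ^ j * Aq.gen q .γ ^ k) := by
  have h : Commute (Aq.gen q .γ) (Aq.gen q .β) := (Aq.βγ q).symm
  simp only [polyBC, eval₂AlgHom_apply, eval₂_monomial, RingHom.coe_coe, aeval_monomial]
  rw [mul_assoc, (h.pow_pow k j).eq, Algebra.smul_def]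

/-- The test element reads off the coefficient of `β^j γ^k`. The exponent `e` of `α` remains visible
as the base of a geometric sequence in `n`, which is why `r` must not depend on `n` or `h`. -/
lemma ev_polyBC (e j k : ℕ) : ∃ r : ℂ, r ≠ 0 ∧ ∀ (n : ℕ) (h : ℂ[X][X]),
    ev (Uq.gen q .C ^ k * Uq.gen q .A ^ n * Uq.gen q .B ^ j)
      (pairingHom q (Aq.gen q .α ^ e * polyBC q h)) =
      r * (h.coeff j).coeff k * qpow q ((e + j + k) / 2) ^ n := by
  obtain ⟨r, hr, hev⟩ := ev_mono q j k e j k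
  refine ⟨r, hr, fun n h ↦ ?_⟩
  induction h using Polynomial.induction_on' with
  | add f g hf hg => rw [map_add, mul_add, map_add, map_add, hf, hg, coeff_add, coeff_add]; ring
  | monomial j' f =>
    induction f using Polynomial.induction_on' with
    | add f g hf hg =>
      rw [map_add (monomial j'), map_add, mul_add, map_add, map_add, hf, hg, coeff_add, coeff_add]
      ring
    | monomial k' z =>
      have hm : pairingHom q (Aq.gen q .α ^ e * polyBC q (monomial j' (monomial k' z))) =
          z • mono q e j' k' := by
        rw [polyBC_monomial, mul_smul_comm, map_smul, mono]
        simp only [map_mul, map_pow, pairingHom_gen, coefGen]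
      rw [hm, map_smul, smul_eq_mul]
      by_cases hjk : j' = j ∧ k' = k
      · obtain ⟨rfl, rfl⟩ := hjk
        rw [hev, if_pos ⟨rfl, rfl⟩, coeff_monomial_same, coeff_monomial_same]
        ring
      · obtain ⟨s, -, hs⟩ := ev_mono q j k e j' k'
        rw [hs, if_neg hjk, coeff_monomial]
        split_ifs with h1
        · rw [coeff_monomial, if_neg (fun h2 ↦ hjk ⟨h1, h2⟩)]; simp
        · simp

/-- The powers of `α` and, for negative exponents, of `δ`. -/
def alphaZPow : ℤ → Aq q
  | .ofNat s => Aq.gen q .α ^ s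
  | .negSucc s => Aq.gen q .δ ^ (s + 1)

variable {q} in
lemma mul_pow_of_smul {x y : Aq q} {c : ℂ} (h : x * y = c • (y * x)) (n : ℕ) :
    x * y ^ n = c ^ n • (y ^ n * x) := by
  induction n with
  | zero => simp
  | succ n ih =>
    rw [pow_succ, ← mul_assoc, ih, smul_mul_assoc, mul_assoc, h, mul_smul_comm, smul_smul,
      mul_assoc, pow_succ]

lemma Aq.βα : gen q .β * gen q .α = (qc q)⁻¹ • (gen q .α * gen q .β) := by
  rw [Aq.αβ, smul_smul, inv_mul_cancel₀ (qc_ne_zero q), one_smul]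

lemma Aq.γα : gen q .γ * gen q .α = (qc q)⁻¹ • (gen q .α * gen q .γ) := by
  rw [Aq.αγ, smul_smul, inv_mul_cancel₀ (qc_ne_zero q), one_smul]

lemma beta_mul_alphaZPow (s : ℤ) : ∃ c : ℂ,
    Aq.gen q .β * alphaZPow q s = c • (alphaZPow q s * Aq.gen q .β) := by
  cases s with
  | ofNat s => exact ⟨_, mul_pow_of_smul (Aq.βα q) s⟩
  | negSucc s => exact ⟨_, mul_pow_of_smul (Aq.βδ q) (s + 1)⟩

lemma gamma_mul_alphaZPow (s : ℤ) : ∃ c : ℂ,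
    Aq.gen q .γ * alphaZPow q s = c • (alphaZPow q s * Aq.gen q .γ) := by
  cases s with
  | ofNat s => exact ⟨_, mul_pow_of_smul (Aq.γα q) s⟩
  | negSucc s => exact ⟨_, mul_pow_of_smul (Aq.γδ q) (s + 1)⟩

/-- `1 + z βγ` moves through powers of elements that `q`-commute with `β` and `γ`. -/
lemma one_add_mul_pow {y : Aq q} {c c' : ℂ} (hb : Aq.gen q .β * y = c • (y * Aq.gen q .β))
    (hc : Aq.gen q .γ * y = c' • (y * Aq.gen q .γ)) (z : ℂ) (t : ℕ) :
    ∃ P : ℂ[X][X], P ≠ 0 ∧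
      (1 + z • (Aq.gen q .γ * Aq.gen q .β)) * y ^ t = y ^ t * polyBC q P := by
  -- Moving `γβ` past `y ^ t` only rescales it; the constant term 1 keeps the polynomial nonzero.
  refine ⟨1 + (z * (c ^ t * c' ^ t)) • (C X * X), ?_, ?_⟩
  · intro h
    have := congrArg (fun p ↦ (p.coeff 0).coeff 0) h
    simp at this
  · rw [map_add, map_one, map_smul, map_mul, polyBC_X, polyBC_C_X, add_mul, mul_add, one_mul,
      mul_one, smul_mul_assoc, mul_assoc, mul_pow_of_smul hb, mul_smul_comm, ← mul_assoc,
      mul_pow_of_smul hc, smul_mul_assoc, mul_smul_comm, smul_smul, smul_smul, mul_assoc, mul_assoc]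

/-- Each adjacent pair `αδ` collapses to `1 + qγβ`, and moving that factor to the right past the
remaining `δ`s changes only the coefficient of `γβ`. The product of these factors is nonzero because
`ℂ[X][X]` is a domain. -/
lemma alpha_pow_mul_delta_pow (n i : ℕ) : ∃ P : ℂ[X][X], P ≠ 0 ∧
    Aq.gen q .α ^ (n + i) * Aq.gen q .δ ^ i = Aq.gen q .α ^ n * polyBC q P := by
  induction i with
  | zero => exact ⟨1, one_ne_zero, by simp⟩
  | succ i ih =>
    obtain ⟨P, hP, h⟩ := ih
    obtain ⟨Q, hQ, h'⟩ := one_add_mul_pow q (Aq.βδ q) (Aq.γδ q) (qc q) i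
    refine ⟨P * Q, mul_ne_zero hP hQ, ?_⟩
    rw [← add_assoc, pow_succ, pow_succ', mul_assoc, ← mul_assoc (Aq.gen q .α), Aq.αδ, h',
      ← mul_assoc, h, map_mul, mul_assoc]

/-- A large power of `α` removes every `δ` at the price of a nonzero polynomial in `β` and `γ`, so
testing on monomials without `δ` suffices. -/
lemma alpha_pow_mul_alphaZPow (n : ℕ) (s : ℤ) (hs : s.natAbs ≤ n) :
    ∃ P : ℂ[X][X], P ≠ 0 ∧ Aq.gen q .α ^ n * alphaZPow q s =
      Aq.gen q .α ^ (n + s).toNat * polyBC q P := by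
  cases s with
  | ofNat s =>
    refine ⟨1, one_ne_zero, ?_⟩
    rw [map_one, mul_one, alphaZPow, ← pow_add]
    rfl
  | negSucc s =>
    obtain ⟨P, hP, h⟩ := alpha_pow_mul_delta_pow q (n - (s + 1)) (s + 1)
    refine ⟨P, hP, ?_⟩
    have e1 : n - (s + 1) + (s + 1) = n := by omega
    have e2 : ((n : ℤ) + Int.negSucc s).toNat = n - (s + 1) := by omega
    rw [e2, ← h, e1, alphaZPow]

/-- Normally ordered elements. -/
def normalForm : (ℤ →₀ ℂ[X][X]) →ₗ[ℂ] Aq q :=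
  Finsupp.lsum ℂ fun s ↦ LinearMap.mulLeft ℂ (alphaZPow q s) ∘ₗ (polyBC q).toLinearMap

lemma normalForm_single (s : ℤ) (g : ℂ[X][X]) :
    normalForm q (Finsupp.single s g) = alphaZPow q s * polyBC q g := by
  simp [normalForm]

lemma mem_range_normalForm (s : ℤ) (g : ℂ[X][X]) :
    alphaZPow q s * polyBC q g ∈ LinearMap.range (normalForm q) :=
  ⟨Finsupp.single s g, normalForm_single q s g⟩

lemma gen_mul_mem_range_normalForm (x : AGen) (s : ℤ) (g : ℂ[X][X]) :
    Aq.gen q x * (alphaZPow q s * polyBC q g) ∈ LinearMap.range (normalForm q) := by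
  rw [← mul_assoc]
  cases x with
  | β =>
    obtain ⟨c, hc⟩ := beta_mul_alphaZPow q s
    rw [hc, ← polyBC_X, smul_mul_assoc, mul_assoc, ← map_mul]
    exact Submodule.smul_mem _ _ (mem_range_normalForm q _ _)
  | γ =>
    obtain ⟨c, hc⟩ := gamma_mul_alphaZPow q s
    rw [hc, ← polyBC_C_X, smul_mul_assoc, mul_assoc, ← map_mul]
    exact Submodule.smul_mem _ _ (mem_range_normalForm q _ _)
  | α =>
    cases s with
    | ofNat s =>
      rw [alphaZPow, ← pow_succ']
      exact mem_range_normalForm q (.ofNat (s + 1)) g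
    | negSucc s =>
      obtain ⟨P, -, h⟩ := one_add_mul_pow q (Aq.βδ q) (Aq.γδ q) (qc q) s
      rw [alphaZPow, pow_succ', ← mul_assoc, Aq.αδ, h, mul_assoc, ← map_mul]
      rcases s with _ | s
      · simpa [alphaZPow] using mem_range_normalForm q (.ofNat 0) (P * g)
      · exact mem_range_normalForm q (.negSucc s) _
  | δ =>
    cases s with
    | ofNat s =>
      rcases s with _ | s
      · have : Aq.gen q .δ * alphaZPow q (.ofNat 0) = alphaZPow q (.negSucc 0) := by
          simp [alphaZPow]
        rw [this]
        exact mem_range_normalForm q _ _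
      · obtain ⟨P, -, h⟩ := one_add_mul_pow q (Aq.βα q) (Aq.γα q) (qc q)⁻¹ s
        rw [alphaZPow, pow_succ', ← mul_assoc, Aq.δα, h, mul_assoc, ← map_mul]
        exact mem_range_normalForm q (.ofNat s) _
    | negSucc s =>
      rw [alphaZPow, ← pow_succ']
      exact mem_range_normalForm q (.negSucc (s + 1)) g

/-- The range is stable under left multiplication by the generators, hence a left ideal, and it
contains 1. -/
lemma normalForm_surjective : Function.Surjective (normalForm q) := by
  rw [← LinearMap.range_eq_top]
  have hgen (x : AGen) (ξ : Aq q) (hξ : ξ ∈ LinearMap.range (normalForm q)) :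
      Aq.gen q x * ξ ∈ LinearMap.range (normalForm q) := by
    obtain ⟨h, rfl⟩ := hξ
    induction h using Finsupp.induction_linear with
    | zero => simp
    | add f g hf hg => rw [map_add, mul_add]; exact Submodule.add_mem _ hf hg
    | single s g => rw [normalForm_single]; exact gen_mul_mem_range_normalForm q x s g
  have hmul (ζ : Aq q) : ∀ ξ ∈ LinearMap.range (normalForm q),
      ζ * ξ ∈ LinearMap.range (normalForm q) := by
    induction ζ using Aq.induction with
    | hc c => intro ξ hξ; rw [← Algebra.smul_def]; exact Submodule.smul_mem _ _ hξ
    | hg x => exact hgen x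
    | hadd x y hx hy =>
      intro ξ hξ; rw [add_mul]; exact Submodule.add_mem _ (hx ξ hξ) (hy ξ hξ)
    | hmul x y hx hy => intro ξ hξ; rw [mul_assoc]; exact hx _ (hy ξ hξ)
  have h1 : (1 : Aq q) ∈ LinearMap.range (normalForm q) := by
    simpa [alphaZPow] using mem_range_normalForm q (.ofNat 0) 1
  exact eq_top_iff.2 fun ξ _ ↦ by simpa using hmul ξ 1 h1

lemma qpow_injective : Function.Injective (qpow q) := by
  intro x y h
  have h' : (q : ℝ) ^ x = (q : ℝ) ^ y := by
    unfold qpow at h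
    exact_mod_cast h
  exact (Real.rpow_right_inj q.2.1 q.2.2.ne).1 h'

lemma pairingHom_injective : Function.Injective (pairingHom q) := by
  classical
  rw [injective_iff_map_eq_zero]
  intro ξ hξ
  obtain ⟨h, rfl⟩ := normalForm_surjective q ξ
  suffices h = 0 by rw [this, map_zero]
  -- The least power of `α` that clears all negative exponents in the support. Since `pairingHom` is
  -- multiplicative, the image of `α ^ n * ξ` vanishes as well, and `α` need not be cancelled in
  -- `A_q(SU(2))`.
  set n := h.support.sup Int.natAbs with hn
  choose! P hP hmul using fun (s : ℤ) (hs : s.natAbs ≤ n) ↦ alpha_pow_mul_alphaZPow q n s hs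
  have hle {s : ℤ} (hs : s ∈ h.support) : s.natAbs ≤ n := Finset.le_sup (f := Int.natAbs) hs
  have hsum : ∑ s ∈ h.support,
      pairingHom q (Aq.gen q .α ^ (n + s).toNat * polyBC q (P s * h s)) = 0 := by
    rw [← map_sum]
    have : ∑ s ∈ h.support, Aq.gen q .α ^ (n + s).toNat * polyBC q (P s * h s) =
        Aq.gen q .α ^ n * normalForm q h := by
      rw [normalForm, Finsupp.lsum_apply, Finsupp.sum, Finset.mul_sum]
      refine Finset.sum_congr rfl fun s hs ↦ ?_
      rw [map_mul, ← mul_assoc, ← hmul s (hle hs), mul_assoc]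
      rfl
    rw [this, map_mul, hξ, mul_zero]
  ext1 s
  by_cases hs : s ∈ h.support
  swap
  · simpa using hs
  suffices P s * h s = 0 from (mul_eq_zero.1 this).resolve_left (hP s (hle hs))
  ext j k
  rw [coeff_zero, coeff_zero]
  choose r hr hev using fun e ↦ ev_polyBC q e j k
  -- For fixed `j` and `k`, distinct `s` give distinct exponents `n + s` (nonnegative by the choice
  -- of `n`, so `toNat` loses nothing), hence distinct bases.
  have hv := eq_zero_of_sum_mul_pow_eq_zero h.support
    (fun s ↦ r (n + s).toNat * ((P s * h s).coeff j).coeff k)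
    (fun s ↦ qpow q (((n + s).toNat + j + k) / 2)) ?_ ?_ hs
  · exact (mul_eq_zero.1 hv).resolve_left (hr _)
  · intro a ha b hb hab
    have h1 := qpow_injective q hab
    have h2 : ((n + a).toNat : ℝ) = (n + b).toNat := by linarith
    have h3 : ((n : ℤ) + a).toNat = ((n : ℤ) + b).toNat := by exact_mod_cast h2
    have := hle ha
    have := hle hb
    omega
  · intro m
    have := congrArg (ev (Uq.gen q .C ^ k * Uq.gen q .A ^ m * Uq.gen q .B ^ j)) hsum
    rw [map_zero, map_sum] at this
    rw [← this]
    exact Finset.sum_congr rfl fun s _ ↦ (hev _ _ _).symm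

end Nondegenerate

section SpinModel

open Polynomial

/-! ### Spin representations on polynomials -/

/-- The linear map on polynomials with prescribed values on the monomials. -/
def onMono (g : ℕ → ℂ[X]) : Module.End ℂ ℂ[X] := (basisMonomials ℂ).constr ℂ g

@[simp] lemma onMono_X_pow (g : ℕ → ℂ[X]) (n : ℕ) : onMono g (X ^ n) = g n := by
  have := (basisMonomials ℂ).constr_basis ℂ g n
  rw [coe_basisMonomials] at this
  rw [← monomial_one_right_eq_X_pow]
  exact this

@[simp] lemma onMono_one (g : ℕ → ℂ[X]) : onMono g 1 = g 0 := by
  rw [← pow_zero (X : ℂ[X]), onMono_X_pow]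

lemma poly_hom_ext {M : Type*} [AddCommGroup M] [Module ℂ M] {f g : ℂ[X] →ₗ[ℂ] M}
    (h : ∀ n : ℕ, f (X ^ n) = g (X ^ n)) : f = g := by
  refine (basisMonomials ℂ).ext fun n ↦ ?_
  rw [coe_basisMonomials]
  simpa only [monomial_one_right_eq_X_pow] using h n

variable (q : Param)

/-- The `q`-number `[x] = (q^{-x} - q^x) / (q⁻¹ - q)`. -/
def qNum (x : ℝ) : ℂ := (qpow q (-x) - qpow q x) / ((qc q)⁻¹ - qc q)

lemma qNum_zero : qNum q 0 = 0 := by simp [qNum]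

lemma qpow_double (x : ℝ) : qpow q x = qpow q (x / 2) * qpow q (x / 2) := by
  rw [← qpow_add, add_halves]

lemma inv_sub_qc_ne_zero : (qc q)⁻¹ - qc q ≠ 0 := by
  rw [← neg_sub, neg_ne_zero]
  exact qc_sub_inv_ne_zero q

/-- The generators in the spin representation on polynomials, `X ^ n` having weight `n - N / 2`. -/
def polyRepGen (N : ℕ) : UGen → Module.End ℂ ℂ[X]
  | .A => onMono fun n ↦ qpow q (n - N / 2) • X ^ n
  | .B => onMono fun n ↦ qNum q (N - n) • X ^ (n + 1)
  | .C => onMono fun n ↦ qNum q n • X ^ (n - 1)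
  | .D => onMono fun n ↦ qpow q (N / 2 - n) • X ^ n

/-- On `X ^ n` this is the q-number identity `[n][N-n+1] - [N-n][n+1] = [2n-N]`. -/
lemma polyRepGen_comm (N : ℕ) : polyRepGen q N .B * polyRepGen q N .C -
    polyRepGen q N .C * polyRepGen q N .B =
    (qc q - (qc q)⁻¹)⁻¹ • (polyRepGen q N .A * polyRepGen q N .A -
      polyRepGen q N .D * polyRepGen q N .D) := by
  refine poly_hom_ext fun n ↦ ?_
  have hB : polyRepGen q N .B (polyRepGen q N .C (X ^ n)) =
      (qNum q n * qNum q (N - n + 1)) • X ^ n := by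
    rcases n with _ | n
    -- The truncated exponent `0 - 1 = 0` is harmless because its coefficient is `[0] = 0`.
    · simp [polyRepGen, qNum_zero]
    · simp only [polyRepGen, onMono_X_pow, map_smul, smul_smul, Nat.add_sub_cancel]
      congr 3
      push_cast
      ring
  have hC : polyRepGen q N .C (polyRepGen q N .B (X ^ n)) =
      (qNum q (N - n) * qNum q (n + 1)) • X ^ n := by
    simp [polyRepGen, smul_smul]
  rw [LinearMap.sub_apply, Module.End.mul_apply, Module.End.mul_apply, hB, hC,
    LinearMap.smul_apply, LinearMap.sub_apply, Module.End.mul_apply, Module.End.mul_apply]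
  simp only [polyRepGen, onMono_X_pow, map_smul, smul_smul, ← sub_smul]
  congr 1
  have hd := inv_sub_qc_ne_zero q
  have hd' := qc_sub_inv_ne_zero q
  have hn := qpow_ne_zero q n
  have hN := qpow_ne_zero q (N / 2)
  have hq := qc_ne_zero q
  have e : (qc q - (qc q)⁻¹)⁻¹ = -((qc q)⁻¹ - qc q)⁻¹ := by rw [← neg_sub, inv_neg]
  have e2 : (qc q)⁻¹ - qc q = (1 - qc q ^ 2) / qc q := by field_simp
  have e3 : 1 - qc q ^ 2 ≠ 0 := by
    intro h; rw [e2, h, zero_div] at hd; exact hd rfl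
  rw [e]
  simp only [qNum, sub_eq_add_neg, neg_add, neg_neg, qpow_add, qpow_neg, qpow_double q N, qpow_one]
  simp only [← sub_eq_add_neg]
  rw [e2]
  field_simp
  ring

/-- The spin representation on polynomials. -/
def polyRep (N : ℕ) : Uq q →ₐ[ℂ] Module.End ℂ ℂ[X] :=
  Uq.lift (polyRepGen q N)
    (poly_hom_ext fun n ↦ by simp [polyRepGen, smul_smul, ← qpow_add, qpow_zero])
    (poly_hom_ext fun n ↦ by simp [polyRepGen, smul_smul, ← qpow_add, qpow_zero])
    (poly_hom_ext fun n ↦ by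
      simp only [polyRepGen, Module.End.mul_apply, onMono_X_pow, map_smul, smul_smul,
        LinearMap.smul_apply, Nat.cast_add, Nat.cast_one, ← qpow_one]
      congr 1
      rw [show (n + 1 - N / 2 : ℝ) = 1 + (n - N / 2) by ring, qpow_add]
      ring)
    (poly_hom_ext fun n ↦ by
      rcases n with _ | n
      · simp [polyRepGen, qNum_zero]
      simp only [polyRepGen, Module.End.mul_apply, onMono_X_pow, map_smul, smul_smul,
        LinearMap.smul_apply, Nat.cast_add, Nat.cast_one, ← qpow_one, Nat.add_sub_cancel]
      congr 1
      rw [show (n + 1 - N / 2 : ℝ) = 1 + (n - N / 2) by ring, qpow_add]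
      have := qpow_ne_zero q 1
      field_simp)
    (polyRepGen_comm q N)

lemma polyRep_gen (N : ℕ) (x : UGen) : polyRep q N (Uq.gen q x) = polyRepGen q N x := by
  simp [polyRep]

/-- For `N = 0` the constants carry the trivial representation, since `[0] = 0` makes `B` and `C`
kill 1. This starts the induction on the number of factors. -/
lemma polyRep_zero_one (X : Uq q) : polyRep q 0 X 1 = Uq.counitHom q X • (1 : ℂ[X]) := by
  induction X using Uq.induction with
  | hc c => simp [Algebra.algebraMap_eq_smul_one]
  | hg x =>
    rw [polyRep_gen, ← pow_zero (Polynomial.X : ℂ[X])]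
    cases x <;> simp [polyRepGen, Uq.counitHom, qNum_zero, qpow_zero]
  | hadd x y hx hy => rw [map_add, LinearMap.add_apply, hx, hy, map_add, add_smul]
  | hmul x y hx hy =>
    rw [map_mul, Module.End.mul_apply, hy, map_smul, hx, smul_smul, map_mul, mul_comm]

/-! ### Fusion with the two-dimensional representation -/

/-- The tensor product of the two-dimensional and the spin representation. -/
def fusionRep (N : ℕ) : Uq q →ₐ[ℂ] Module.End ℂ ((Fin 2 → ℂ) ⊗[ℂ] ℂ[X]) :=
  (Module.endTensorEndAlgHom (R := ℂ) (S := ℂ) (A := ℂ)).comp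
    ((Algebra.TensorProduct.map ((Matrix.toLinAlgEquiv' (R := ℂ)).toAlgHom.comp (funRep q))
      (polyRep q N)).comp (Uq.comulHom q))

/-- The intertwiner from the fused representation to the next spin representation. -/
def fusion (N : ℕ) : (Fin 2 → ℂ) ⊗[ℂ] ℂ[X] →ₗ[ℂ] ℂ[X] :=
  TensorProduct.lift (LinearMap.mk₂ ℂ
    (fun v f ↦ (C (qpow q (N / 2) * v 0) * X + C (v 1)) * f.comp (C (qpow q (-(1 / 2))) * X))
    (fun v w f ↦ by simp only [Pi.add_apply, mul_add, map_add]; ring)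
    (fun c v f ↦ by
      simp only [Pi.smul_apply, smul_eq_mul, smul_eq_C_mul, map_mul]; ring)
    (fun v f g ↦ by rw [add_comp]; ring)
    (fun c v f ↦ by rw [smul_comp, mul_smul_comm]))

lemma fusion_tmul (N : ℕ) (v : Fin 2 → ℂ) (f : ℂ[X]) : fusion q N (v ⊗ₜ f) =
    (C (qpow q (N / 2) * v 0) * X + C (v 1)) * f.comp (C (qpow q (-(1 / 2))) * X) := rfl

lemma fusion_tmul_X_pow (N : ℕ) (v : Fin 2 → ℂ) (n : ℕ) : fusion q N (v ⊗ₜ (X ^ n)) =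
    (qpow q (N / 2) * (qpow q (n / 2))⁻¹ * v 0) • X ^ (n + 1) +
      ((qpow q (n / 2))⁻¹ * v 1) • X ^ n := by
  have h : qpow q (-(1 / 2)) ^ n = (qpow q (n / 2))⁻¹ := by
    rw [qpow_pow, ← qpow_neg]; congr 1; ring
  rw [fusion_tmul, X_pow_comp, mul_pow, ← C_pow, h, smul_eq_C_mul, smul_eq_C_mul]
  simp only [map_mul]
  ring

lemma fusionRep_gen_tmul (N : ℕ) (v : Fin 2 → ℂ) (f : ℂ[X]) :
    fusionRep q N (Uq.gen q .A) (v ⊗ₜ f) =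
      (funRepGen q .A *ᵥ v) ⊗ₜ polyRepGen q N .A f ∧
    fusionRep q N (Uq.gen q .B) (v ⊗ₜ f) =
      (funRepGen q .A *ᵥ v) ⊗ₜ polyRepGen q N .B f +
        (funRepGen q .B *ᵥ v) ⊗ₜ polyRepGen q N .D f ∧
    fusionRep q N (Uq.gen q .C) (v ⊗ₜ f) =
      (funRepGen q .A *ᵥ v) ⊗ₜ polyRepGen q N .C f +
        (funRepGen q .C *ᵥ v) ⊗ₜ polyRepGen q N .D f ∧
    fusionRep q N (Uq.gen q .D) (v ⊗ₜ f) =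
      (funRepGen q .D *ᵥ v) ⊗ₜ polyRepGen q N .D f := by
  refine ⟨?_, ?_, ?_, ?_⟩ <;>
  · simp only [fusionRep, AlgHom.comp_apply, Uq.comulHom_gen, Uq.comulGen, map_add,
      Algebra.TensorProduct.map_tmul, funRep_gen, polyRep_gen]
    rfl

-- On `v ⊗ X ^ n` the claim compares the coefficients at `v 0` and `v 1`. Each comparison is a
-- rational identity in `q^{1/2}`, `q^{n/2}` and `q^{N/2}`.
set_option linter.unusedSimpArgs false in
lemma fusion_fusionRep_gen (N : ℕ) (x : UGen) (v : Fin 2 → ℂ) (n : ℕ) :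
    fusion q N (fusionRep q N (Uq.gen q x) (v ⊗ₜ (X ^ n))) =
      polyRepGen q (N + 1) x (fusion q N (v ⊗ₜ (X ^ n))) := by
  obtain ⟨hA, hB, hC, hD⟩ := fusionRep_gen_tmul q N v (X ^ n)
  have hn := qpow_ne_zero q (n / 2)
  have hN := qpow_ne_zero q (N / 2)
  have hh := qpow_ne_zero q (1 / 2)
  have hq := qpow_half_sq q
  have hd := inv_sub_qc_ne_zero q
  have e2 : (qc q)⁻¹ - qc q = (1 - qpow q (1 / 2) ^ 4) / qpow q (1 / 2) ^ 2 := by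
    rw [← hq]; field_simp
  have e3 : 1 - qpow q (1 / 2) ^ 4 ≠ 0 := by
    intro h; rw [e2, h, zero_div] at hd; exact hd rfl
  have em : qpow q (-(1 / 2)) = (qpow q (1 / 2))⁻¹ := qpow_neg q _
  have v0 (M : Matrix (Fin 2) (Fin 2) ℂ) (i : Fin 2) :
      (M *ᵥ v) i = M i 0 * v 0 + M i 1 * v 1 := by
    simp [Matrix.mulVec, dotProduct, Fin.sum_univ_two]
  cases x with
  | A =>
    rw [hA]
    simp only [polyRepGen, onMono_X_pow, TensorProduct.tmul_smul, map_smul, map_add,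
      fusion_tmul_X_pow, smul_add, smul_smul, v0, funRepGen, Matrix.of_apply, Matrix.cons_val_zero,
      Matrix.cons_val_one, zero_mul, add_zero, zero_add, Nat.cast_add, Nat.cast_one]
    simp only [em, sub_eq_add_neg, add_div, neg_div, neg_add, neg_neg, qpow_add, qpow_neg,
      qpow_double q n, qpow_double q N, qpow_double q 1]
    match_scalars <;> field_simp
  | B =>
    rw [hB]
    simp only [polyRepGen, onMono_X_pow, TensorProduct.tmul_smul, map_smul, map_add,
      fusion_tmul_X_pow, smul_add, smul_smul, v0, funRepGen, Matrix.of_apply, Matrix.cons_val_zero,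
      Matrix.cons_val_one, zero_mul, add_zero, zero_add, Nat.cast_add, Nat.cast_one, one_mul]
    simp only [em, qNum, e2, sub_eq_add_neg, add_div, neg_div, neg_add, neg_neg, qpow_add, qpow_neg,
      qpow_double q n, qpow_double q N, qpow_double q 1]
    simp only [← sub_eq_add_neg]
    match_scalars <;> field_simp <;> ring
  | C =>
    rw [hC]
    -- For `n = 0` the exponent `n - 1` is truncated, so the general computation does not apply.
    rcases n with _ | n
    · have e1 : qNum q (1 : ℕ) = 1 := by
        rw [qNum, Nat.cast_one, qpow_neg, qpow_one, div_self hd]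
      simp only [fusion_tmul_X_pow, polyRepGen, onMono_X_pow, map_add, map_smul, e1, zero_add,
        Nat.cast_zero, qNum_zero, zero_smul, smul_zero, TensorProduct.tmul_zero, map_zero,
        TensorProduct.tmul_smul, v0, funRepGen, Matrix.of_apply, Matrix.cons_val_zero, add_zero,
        Matrix.cons_val_one, zero_mul, one_mul, one_smul, mul_zero, smul_smul, Nat.sub_self,
        sub_zero, zero_div, qpow_zero, inv_one, mul_one]
    · simp only [polyRepGen, onMono_X_pow, TensorProduct.tmul_smul, map_smul, map_add,
        fusion_tmul_X_pow, smul_add, smul_smul, v0, funRepGen, Matrix.of_apply,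
        Matrix.cons_val_zero, Nat.add_sub_cancel,
        Matrix.cons_val_one, zero_mul, add_zero, zero_add, Nat.cast_add, Nat.cast_one, one_mul]
      rw [Nat.cast_add, Nat.cast_one] at hn
      simp only [em, qNum, e2, sub_eq_add_neg, add_div, neg_div, neg_add, neg_neg, qpow_add,
        qpow_neg, qpow_double q n, qpow_double q N, qpow_double q 1] at hn ⊢
      simp only [← sub_eq_add_neg]
      have hn' := qpow_ne_zero q (n / 2)
      match_scalars <;> field_simp <;> ring
  | D =>
    rw [hD]
    simp only [polyRepGen, onMono_X_pow, TensorProduct.tmul_smul, map_smul, map_add,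
      fusion_tmul_X_pow, smul_add, smul_smul, v0, funRepGen, Matrix.of_apply, Matrix.cons_val_zero,
      Matrix.cons_val_one, zero_mul, add_zero, zero_add, Nat.cast_add, Nat.cast_one]
    simp only [em, sub_eq_add_neg, add_div, neg_div, neg_add, neg_neg, qpow_add, qpow_neg,
      qpow_double q n, qpow_double q N, qpow_double q 1]
    match_scalars <;> field_simp

end SpinModel

/-! ### Products of rank one elements as matrix elements of spin representations -/

section ProductFormula

open Polynomial

variable (q : Param)

lemma fusion_fusionRep (N : ℕ) (X : Uq q) :
    fusion q N ∘ₗ fusionRep q N X = polyRep q (N + 1) X ∘ₗ fusion q N := by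
  induction X using Uq.induction with
  | hc c =>
    refine LinearMap.ext fun t ↦ ?_
    simp [Algebra.algebraMap_eq_smul_one]
  | hg x =>
    refine TensorProduct.ext (LinearMap.ext fun v ↦ poly_hom_ext fun n ↦ ?_)
    have h := fusion_fusionRep_gen q N x v n
    rw [← polyRep_gen] at h
    exact h
  | hadd x y hx hy => rw [map_add, map_add, LinearMap.comp_add, hx, hy, LinearMap.add_comp]
  | hmul x y hx hy =>
    rw [map_mul, map_mul, Module.End.mul_eq_comp, Module.End.mul_eq_comp, ← LinearMap.comp_assoc,
      hx, LinearMap.comp_assoc, hy, LinearMap.comp_assoc]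

/-- The combination of the generators with rank one coefficient matrix `u wᵀ`. -/
def rankOne (u w : Fin 2 → ℂ) : Aq q :=
  (u 0 * w 0) • Aq.gen q .α + (u 0 * w 1) • Aq.gen q .β + (u 1 * w 0) • Aq.gen q .γ +
    (u 1 * w 1) • Aq.gen q .δ

lemma ev_rankOne (u w : Fin 2 → ℂ) (X : Uq q) :
    ev X (pairingHom q (rankOne q u w)) = u ⬝ᵥ (funRep q X *ᵥ w) := by
  obtain ⟨h1, h2, h3, h4⟩ := pairing_gen q X
  rw [← pairing_eq_ev, rankOne]
  simp only [map_add, map_smul, h1, h2, h3, h4, smul_eq_mul, Matrix.mulVec, dotProduct,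
    Fin.sum_univ_two]
  ring

/-- `ξ` is the matrix element of the spin representation with column `f` and the row given by
evaluation at `i q^{τ + (N - 1) / 2}`. -/
def IsEvalElt (N : ℕ) (τ : ℝ) (ξ : Aq q) (f : ℂ[X]) : Prop :=
  ∀ Y : Uq q, pairing q Y ξ =
    (polyRep q N Y f).eval (Complex.I * qpow q (τ + (N - 1) / 2))

lemma isEvalElt_one (τ : ℝ) : IsEvalElt q 0 τ 1 1 := by
  intro Y
  rw [polyRep_zero_one, pairing_eq_ev, map_one, ev_one]
  simp

/-- The dilation by `q^{-1/2}` inside `fusion` carries the evaluation point for `N + 1` to the one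
for `N`. The linear factor, evaluated at the new point, gives the vector `(i q^{τ+N}, 1)`, which
explains the unit shifts of the first index along the products. -/
lemma eval_fusion (N : ℕ) (τ : ℝ) (v : Fin 2 → ℂ) (f : ℂ[X]) :
    (fusion q N (v ⊗ₜ f)).eval (Complex.I * qpow q (τ + ((N + 1 : ℕ) - 1) / 2)) =
      (![Complex.I * qpow q (τ + N), 1] ⬝ᵥ v) * f.eval (Complex.I * qpow q (τ + (N - 1) / 2)) := by
  rw [fusion_tmul, eval_mul, eval_comp]
  simp only [eval_add, eval_mul, eval_C, eval_X]
  have e1 : qpow q (-(1 / 2)) * (Complex.I * qpow q (τ + ((N + 1 : ℕ) - 1) / 2)) =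
      Complex.I * qpow q (τ + (N - 1) / 2) := by
    rw [mul_left_comm, ← qpow_add]
    congr 2
    push_cast
    ring
  have e2 : qpow q (τ + N) = qpow q (N / 2) * qpow q (τ + ((N + 1 : ℕ) - 1) / 2) := by
    rw [← qpow_add]
    congr 1
    push_cast
    ring
  rw [e1, e2]
  simp only [dotProduct, Fin.sum_univ_two, Matrix.cons_val_zero, Matrix.cons_val_one, one_mul]
  ring

/-- The convolution product is read off from `Δ(Y)`. On a pure tensor it factors exactly as
evaluation after `fusion` does, and the intertwining property then moves `Y` past `fusion`. -/
lemma IsEvalElt.rankOne_mul {N : ℕ} {τ : ℝ} {ξ : Aq q} {f : ℂ[X]} (h : IsEvalElt q N τ ξ f)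
    (w : Fin 2 → ℂ) :
    IsEvalElt q (N + 1) τ (rankOne q ![Complex.I * qpow q (τ + N), 1] w * ξ)
      (fusion q N (w ⊗ₜ f)) := by
  intro Y
  rw [pairing_eq_ev, map_mul, ev_mul]
  have key (t : Uq q ⊗[ℂ] Uq q) :
      evTensor (pairingHom q (rankOne q ![Complex.I * qpow q (τ + N), 1] w)) (pairingHom q ξ) t =
      (fusion q N ((Module.endTensorEndAlgHom (R := ℂ) (S := ℂ) (A := ℂ)
        (Algebra.TensorProduct.map ((Matrix.toLinAlgEquiv' (R := ℂ)).toAlgHom.comp (funRep q))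
          (polyRep q N) t)) (w ⊗ₜ f))).eval
            (Complex.I * qpow q (τ + ((N + 1 : ℕ) - 1) / 2)) := by
    induction t using TensorProduct.induction_on with
    | zero => simp
    | add x y hx hy => simp only [map_add, LinearMap.add_apply, eval_add, hx, hy]
    | tmul x y =>
      have e : Module.endTensorEndAlgHom (R := ℂ) (S := ℂ) (A := ℂ)
          (Algebra.TensorProduct.map ((Matrix.toLinAlgEquiv' (R := ℂ)).toAlgHom.comp (funRep q))
          (polyRep q N) (x ⊗ₜ y)) (w ⊗ₜ f) = (funRep q x *ᵥ w) ⊗ₜ (polyRep q N y f) := by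
        rw [Algebra.TensorProduct.map_tmul]
        rfl
      rw [e, eval_fusion, evTensor_tmul, ev_rankOne, ← pairing_eq_ev, h]
  rw [key]
  exact congrArg (eval _) (LinearMap.congr_fun (fusion_fusionRep q N Y) (w ⊗ₜ f))

/-- The coefficient of `α` is `(i q^τ)(i q^{1/2})`, so the minus sign comes from `i² = -1`. -/
lemma gammaElt_eq (τ σ : ℝ) : gammaElt q τ σ =
    rankOne q ![Complex.I * qpow q τ, 1] ![Complex.I * qpow q (1 / 2), qpow q (σ - 1 / 2)] := by
  simp only [gammaElt, rankOne, Matrix.cons_val_zero, Matrix.cons_val_one, one_mul]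
  rw [add_sub_assoc τ σ, qpow_add q τ, qpow_add q τ]
  congr 4
  · linear_combination (-qpow q τ * qpow q (1 / 2)) * Complex.I_mul_I
  · ring

lemma deltaElt_eq (τ σ : ℝ) : deltaElt q τ σ =
    rankOne q ![Complex.I * qpow q τ, 1]
      ![-Complex.I * qpow q (σ + 1 / 2), qpow q (-(1 / 2))] := by
  simp only [deltaElt, rankOne, Matrix.cons_val_zero, Matrix.cons_val_one, one_mul]
  rw [add_assoc τ σ, sub_eq_add_neg τ, qpow_add q τ, qpow_add q τ, sub_eq_add_neg, ← neg_smul]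
  congr 4
  · linear_combination (qpow q τ * qpow q (σ + 1 / 2)) * Complex.I_mul_I
  · ring
  · ring

/-- The generating polynomial `(-p^{-σ} t; p)_x (t; p)_k` of the dual `q`-Krawtchouk polynomials. -/
def genPoly (p σ : ℝ) (x k : ℕ) : ℝ[X] :=
  (∏ i ∈ Finset.range x, (1 + C (p ^ (-σ) * p ^ i) * X)) *
    ∏ i ∈ Finset.range k, (1 - C (p ^ i) * X)

lemma genPoly_succ_right (p σ : ℝ) (x k : ℕ) :
    genPoly p σ x (k + 1) = genPoly p σ x k * (1 - C (p ^ k) * X) := by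
  rw [genPoly, Finset.prod_range_succ, genPoly, mul_assoc]

lemma genPoly_succ_left (p σ : ℝ) (x k : ℕ) :
    genPoly p σ (x + 1) k = genPoly p σ x k * (1 + C (p ^ (-σ) * p ^ x) * X) := by
  rw [genPoly, Finset.prod_range_succ, genPoly]
  ring

/-- The column of the product formula. -/
def columnPoly (σ : ℝ) (x k : ℕ) : ℂ[X] :=
  C (qpow q (σ * x - x * (x - 1) / 2 - (x + k) / 2)) *
    ((genPoly ((q : ℝ) ^ 2) σ x k).map Complex.ofRealHom).comp
      (C (Complex.I * qpow q (σ + (3 - (x + k)) / 2)) * X)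

lemma qc_sq_pow (i : ℕ) : ((((q : ℝ) ^ 2) ^ i : ℝ) : ℂ) = qpow q (2 * i) := by
  rw [qpow, ← pow_mul, ← Real.rpow_natCast]
  push_cast
  rfl

lemma qc_sq_rpow (x : ℝ) : ((((q : ℝ) ^ 2) ^ x : ℝ) : ℂ) = qpow q (2 * x) := by
  rw [qpow, ← Real.rpow_natCast, ← Real.rpow_mul q.2.1.le]
  push_cast
  rfl

lemma columnPoly_zero (σ : ℝ) : columnPoly q σ 0 0 = 1 := by
  simp [columnPoly, genPoly, qpow_zero]

/-- `fusion` multiplies the dilated column by `q^{N/2} w₀ X + w₁`, where `N = x + k`. The hypotheses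
on `z` and `z'` say that this factor, together with the scalar `q^c` of the column, equals `z (1 +
z' t)` in the new variable `t = i q^{c'} X`. The cases of `γ` and `δ` differ only in `w`, `z` and
`z'`. -/
lemma fusion_columnPoly (σ : ℝ) (x k : ℕ) (w : Fin 2 → ℂ) (c c' : ℝ) (z z' : ℂ)
    (hc : c = σ * x - x * (x - 1) / 2 - (x + k) / 2) (hc' : c' = σ + (3 - (x + k)) / 2 - 1 / 2)
    (h0 : qpow q ((x + k : ℕ) / 2) * w 0 * qpow q c = z * z' * (Complex.I * qpow q c'))
    (h1 : w 1 * qpow q c = z) :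
    fusion q (x + k) (w ⊗ₜ columnPoly q σ x k) =
      C z * ((genPoly ((q : ℝ) ^ 2) σ x k).map Complex.ofRealHom).comp
        (C (Complex.I * qpow q c') * X) * (1 + C z' * (C (Complex.I * qpow q c') * X)) := by
  have e : C (Complex.I * qpow q (σ + (3 - (x + k)) / 2)) * (C (qpow q (-(1 / 2))) * X) =
      C (Complex.I * qpow q c') * X := by
    rw [hc', sub_eq_add_neg _ (1 / 2 : ℝ), qpow_add q _ (-(1 / 2)), ← mul_assoc, ← C_mul, mul_assoc]
  rw [fusion_tmul, columnPoly, mul_comp, comp_assoc, C_comp, mul_comp, C_comp, X_comp, e, ← hc]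
  have h0' := congrArg C h0
  have h1' := congrArg C h1
  simp only [C_mul] at h0' h1' ⊢
  linear_combination (h0' * X + h1') *
    ((genPoly ((q : ℝ) ^ 2) σ x k).map Complex.ofRealHom).comp (C Complex.I * C (qpow q c') * X)

/-- Here `z' = -p^k`, the next factor of `(t; p)_k`. -/
lemma fusion_columnPoly_delta (σ : ℝ) (x k : ℕ) :
    fusion q (x + k) (![-Complex.I * qpow q (σ + k - x + 1 / 2), qpow q (-(1 / 2))] ⊗ₜ
      columnPoly q σ x k) = columnPoly q σ x (k + 1) := by
  rw [fusion_columnPoly q σ x k _ _ _ (qpow q (σ * x - x * (x - 1) / 2 - (x + (k + 1 : ℕ)) / 2))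
    (-qpow q (2 * k)) rfl rfl, columnPoly, genPoly_succ_right]
  · rw [mul_assoc, show (σ + (3 - ((x : ℝ) + (k + 1 : ℕ))) / 2) =
      σ + (3 - (x + k)) / 2 - 1 / 2 by push_cast; ring]
    simp [← qc_sq_pow, sub_eq_add_neg]
  · have key : qpow q ((x + k : ℕ) / 2) * qpow q (σ + k - x + 1 / 2) *
        qpow q (σ * x - x * (x - 1) / 2 - (x + k) / 2) =
        qpow q (σ * x - x * (x - 1) / 2 - (x + (k + 1 : ℕ)) / 2) * qpow q (2 * k) *
        qpow q (σ + (3 - (x + k)) / 2 - 1 / 2) := by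
      simp only [← qpow_add]
      congr 1
      push_cast
      ring
    simp only [Matrix.cons_val_zero]
    linear_combination -Complex.I * key
  · change qpow q _ * qpow q _ = _
    rw [← qpow_add]
    congr 1
    push_cast
    ring

/-- Here `z' = p^{-σ} p^x`, the next factor of `(-p^{-σ}t; p)_x`. The case `k = 0` suffices, as the
`γ`s stand to the right of the `δ`s in the product. -/
lemma fusion_columnPoly_gamma (σ : ℝ) (x : ℕ) :
    fusion q (x + 0) (![Complex.I * qpow q (1 / 2), qpow q (σ - x - 1 / 2)] ⊗ₜ
      columnPoly q σ x 0) = columnPoly q σ (x + 1) 0 := by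
  rw [fusion_columnPoly q σ x 0 _ _ _
    (qpow q (σ * (x + 1 : ℕ) - (x + 1 : ℕ) * ((x + 1 : ℕ) - 1) / 2 - ((x + 1 : ℕ) + (0 : ℕ)) / 2))
    (qpow q (2 * -σ + 2 * x)) rfl rfl, columnPoly, genPoly_succ_left]
  · rw [mul_assoc, show (σ + (3 - (((x + 1 : ℕ) : ℝ) + (0 : ℕ))) / 2) =
      σ + (3 - (x + (0 : ℕ))) / 2 - 1 / 2 by push_cast; ring, qpow_add q (2 * -σ), ← qc_sq_pow,
      ← qc_sq_rpow]
    simp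
  · have key : qpow q ((x + 0 : ℕ) / 2) * qpow q (1 / 2) *
        qpow q (σ * x - x * (x - 1) / 2 - (x + (0 : ℕ)) / 2) =
        qpow q (σ * (x + 1 : ℕ) - (x + 1 : ℕ) * ((x + 1 : ℕ) - 1) / 2 -
          ((x + 1 : ℕ) + (0 : ℕ)) / 2) * qpow q (2 * -σ + 2 * x) *
        qpow q (σ + (3 - (x + (0 : ℕ))) / 2 - 1 / 2) := by
      simp only [← qpow_add]
      congr 1
      push_cast
      ring
    simp only [Matrix.cons_val_zero]
    linear_combination Complex.I * key
  · change qpow q _ * qpow q _ = _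
    rw [← qpow_add]
    congr 1
    push_cast
    ring

/-- The ordered product of the elements `γ`. -/
def gammaProd (τ σ : ℝ) (x : ℕ) : Aq q :=
  ((List.range x).map fun j : ℕ ↦ gammaElt q (τ + x - 1 - j) (σ - x + 1 + j)).prod

/-- The ordered product of the elements `δ`. -/
def deltaProd (τ σ : ℝ) (x k : ℕ) : Aq q :=
  ((List.range k).map fun j : ℕ ↦ deltaElt q (τ + (x + k) - 1 - j) (σ + k - x - 1 - j)).prod

lemma gammaProd_succ (τ σ : ℝ) (x : ℕ) : gammaProd q τ σ (x + 1) =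
    gammaElt q (τ + x) (σ - x) * gammaProd q τ σ x := by
  rw [gammaProd, List.range_succ_eq_map, List.map_cons, List.prod_cons, List.map_map, gammaProd]
  congr 1
  · congr 1 <;> · push_cast; ring
  · congr 1
    refine List.map_congr_left fun j _ ↦ ?_
    simp only [Function.comp_apply]
    congr 1 <;> · push_cast; ring

lemma deltaProd_succ (τ σ : ℝ) (x k : ℕ) : deltaProd q τ σ x (k + 1) =
    deltaElt q (τ + (x + k)) (σ + k - x) * deltaProd q τ σ x k := by
  rw [deltaProd, List.range_succ_eq_map, List.map_cons, List.prod_cons, List.map_map, deltaProd]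
  congr 1
  · congr 1 <;> · push_cast; ring
  · congr 1
    refine List.map_congr_left fun j _ ↦ ?_
    simp only [Function.comp_apply]
    congr 1 <;> · push_cast; ring

lemma isEvalElt_gammaProd (τ σ : ℝ) (x : ℕ) :
    IsEvalElt q (x + 0) τ (gammaProd q τ σ x) (columnPoly q σ x 0) := by
  induction x with
  | zero => simpa [columnPoly_zero, gammaProd] using isEvalElt_one q τ
  | succ x ih =>
    rw [gammaProd_succ, gammaElt_eq, ← fusion_columnPoly_gamma]
    exact ih.rankOne_mul q _

/-- The ordered product is a matrix element of the spin representation. -/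
lemma isEvalElt_prod (τ σ : ℝ) (x k : ℕ) :
    IsEvalElt q (x + k) τ (deltaProd q τ σ x k * gammaProd q τ σ x) (columnPoly q σ x k) := by
  induction k with
  | zero => simpa [deltaProd] using isEvalElt_gammaProd q τ σ x
  | succ k ih =>
    rw [deltaProd_succ, deltaElt_eq, ← fusion_columnPoly_delta, mul_assoc]
    have := ih.rankOne_mul q ![-Complex.I * qpow q (σ + k - x + 1 / 2), qpow q (-(1 / 2))]
    rwa [Nat.cast_add] at this

end ProductFormula

section Krawtchouk

open Polynomial

/-! ### The generating function of the dual `q`-Krawtchouk polynomials -/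

lemma qPoch_succ (a p : ℝ) (k : ℕ) : qPoch a p (k + 1) = qPoch a p k * (1 - a * p ^ k) := by
  rw [qPoch, Finset.prod_range_succ, qPoch]

lemma qPoch_add (a p : ℝ) (k m : ℕ) :
    qPoch a p (k + m) = qPoch a p k * qPoch (a * p ^ k) p m := by
  simp only [qPoch, Finset.prod_range_add, pow_add, mul_assoc]

lemma qPoch_zero (a p : ℝ) : qPoch a p 0 = 1 := by simp [qPoch]

lemma qPoch_succ' (a p : ℝ) (k : ℕ) : qPoch a p (k + 1) = (1 - a) * qPoch (a * p) p k := by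
  rw [add_comm, qPoch_add, ← zero_add 1, qPoch_succ, qPoch_zero]
  simp

lemma zero_qPoch (p : ℝ) (k : ℕ) : qPoch 0 p k = 1 := by simp [qPoch]

variable {p : ℝ}

lemma qPoch_self_pos (h0 : 0 < p) (h1 : p < 1) (k : ℕ) : 0 < qPoch p p k :=
  Finset.prod_pos fun i _ ↦ by
    rw [← pow_succ']
    exact sub_pos.2 (pow_lt_one₀ h0.le h1 i.succ_ne_zero)

lemma qPoch_pow_inv_eq_zero (h0 : 0 < p) {m j : ℕ} (h : m < j) : qPoch (p ^ m) p⁻¹ j = 0 :=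
  Finset.prod_eq_zero (Finset.mem_range.2 h) (by
    rw [← mul_pow, mul_inv_cancel₀ h0.ne', one_pow, sub_self])

lemma qPoch_pow_inv_pos (h0 : 0 < p) (h1 : p < 1) {m j : ℕ} (h : j ≤ m) :
    0 < qPoch (p ^ m) p⁻¹ j :=
  Finset.prod_pos fun i hi ↦ by
    have hi' := Finset.mem_range.1 hi
    rw [inv_pow, ← pow_sub₀ p h0.ne' (by omega)]
    exact sub_pos.2 (pow_lt_one₀ h0.le h1 (by omega))

/-- Each factor `1 - a⁻¹ p^i` equals `-a⁻¹ p^i (1 - a p^{-i})`; the powers of `p` accumulate to a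
binomial exponent. -/
lemma qPoch_inv (h0 : 0 < p) {a : ℝ} (ha : a ≠ 0) (k : ℕ) :
    qPoch a⁻¹ p k = (-1) ^ k * (a ^ k)⁻¹ * p ^ (k.choose 2) * qPoch a p⁻¹ k := by
  induction k with
  | zero => simp [qPoch_zero]
  | succ k ih =>
    rw [qPoch_succ, qPoch_succ, ih, Nat.choose_succ_succ' k 1, Nat.choose_one_right, pow_add, inv_pow]
    field_simp
    ring

lemma qPoch_self_add (h0 : 0 < p) (j a : ℕ) :
    qPoch p p (j + a) = qPoch (p ^ (j + a)) p⁻¹ j * qPoch p p a := by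
  induction j with
  | zero => simp [qPoch_zero]
  | succ j ih =>
    rw [add_right_comm, qPoch_succ, ih, qPoch_succ', pow_succ, mul_inv_cancel_right₀ h0.ne']
    ring

lemma qBinom_zero_right (m : ℕ) : qBinom p m 0 = 1 := by simp [qBinom, qPoch_zero]

lemma qBinom_eq_zero (h0 : 0 < p) {m j : ℕ} (h : m < j) : qBinom p m j = 0 := by
  rw [qBinom, qPoch_pow_inv_eq_zero h0 h, zero_div]

lemma qBinom_pos (h0 : 0 < p) (h1 : p < 1) {m j : ℕ} (h : j ≤ m) : 0 < qBinom p m j :=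
  div_pos (qPoch_pow_inv_pos h0 h1 h) (qPoch_self_pos h0 h1 j)

/-- The q-Pascal rule; the inverse power `(p ^ j)⁻¹` stands for `p ^ (m - j)` without truncated
subtraction. -/
lemma qBinom_succ_succ (h0 : 0 < p) (h1 : p < 1) (m j : ℕ) :
    qBinom p (m + 1) (j + 1) = qBinom p m (j + 1) + p ^ m * (p ^ j)⁻¹ * qBinom p m j := by
  have h := (qPoch_self_pos h0 h1 j).ne'
  have h' := (qPoch_self_pos h0 h1 (j + 1)).ne'
  rw [qPoch_succ] at h'
  have h'' := right_ne_zero_of_mul h'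
  rw [qBinom, qBinom, qBinom, qPoch_succ', pow_succ, mul_inv_cancel_right₀ h0.ne',
    qPoch_succ (p ^ m), qPoch_succ, inv_pow]
  field_simp
  ring

/-- The homogeneous form of the `q`-binomial theorem. -/
lemma qPoch_mul_eq_sum (h0 : 0 < p) (h1 : p < 1) (y u : ℝ) (x : ℕ) :
    qPoch (y * u) p x =
      ∑ j ∈ Finset.range (x + 1), qBinom p x j * qPoch y p j * u ^ j * qPoch u p (x - j) := by
  induction x with
  | zero => simp [qPoch_zero, qBinom_zero_right]
  | succ x ih =>
    -- The first q-Pascal term, joined with the `j = 0` summand, is a sum over `[x, j]` again. The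
    -- second term matches it index by index, and `(1 - u p^{x-j}) + p^{x-j} u (1 - y p^j) = 1 - y u
    -- p^x` closes the induction.
    have hfirst : ∑ j ∈ Finset.range (x + 1),
        qBinom p x (j + 1) * qPoch y p (j + 1) * u ^ (j + 1) * qPoch u p (x - j) +
          qPoch u p (x + 1) =
        ∑ j ∈ Finset.range (x + 1), qBinom p x j * qPoch y p j * u ^ j * qPoch u p (x + 1 - j) := by
      have := Finset.sum_range_succ' (fun j ↦
        qBinom p x j * qPoch y p j * u ^ j * qPoch u p (x + 1 - j)) (x + 1)
      rw [Finset.sum_range_succ, qBinom_eq_zero h0 (Nat.lt_succ_self x)] at this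
      simp only [zero_mul, add_zero, Nat.add_sub_add_right, qBinom_zero_right, qPoch_zero, pow_zero,
        one_mul, Nat.sub_zero] at this
      exact this.symm
    rw [Finset.sum_range_succ', qBinom_zero_right, qPoch_zero, pow_zero, Nat.sub_zero, one_mul,
      one_mul, one_mul]
    simp only [qBinom_succ_succ h0 h1, add_mul, Finset.sum_add_distrib, Nat.add_sub_add_right]
    rw [add_right_comm, hfirst, ← Finset.sum_add_distrib, qPoch_succ, ih, Finset.sum_mul]
    refine Finset.sum_congr rfl fun j hj ↦ ?_
    have hj' : j ≤ x := Nat.lt_succ_iff.1 (Finset.mem_range.1 hj)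
    obtain ⟨a, rfl⟩ := Nat.exists_eq_add_of_le hj'
    rw [show j + a + 1 - j = a + 1 by omega, show j + a - j = a by omega, qPoch_succ, qPoch_succ,
      pow_add]
    field_simp
    ring

lemma coeff_prod_one_sub (h0 : 0 < p) (h1 : p < 1) (m j : ℕ) :
    (∏ i ∈ Finset.range m, (1 - C (p ^ i) * X)).coeff j =
      (-1) ^ j * p ^ (j.choose 2) * qBinom p m j := by
  induction m generalizing j with
  | zero =>
    rcases j with _ | j
    · simp [qBinom_zero_right]
    · rw [qBinom_eq_zero h0 j.succ_pos]
      simp [coeff_one]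
  | succ m ih =>
    rw [Finset.prod_range_succ, mul_sub, mul_one, coeff_sub, ih, mul_left_comm, coeff_C_mul]
    rcases j with _ | j
    · simp [qBinom_zero_right]
    · rw [coeff_mul_X, ih, qBinom_succ_succ h0 h1, Nat.choose_succ_succ' j 1, Nat.choose_one_right,
        pow_add]
      field_simp
      ring

/-- Apply the q-binomial theorem to `(yu; p)_x` with `u = p^k t` and `y = -p^{-σ-k}`. This choice
lets `(t; p)_k` absorb `(p^k t; p)_{x-j}` into `(t; p)_{x+k-j}`, while `y` becomes the third
numerator parameter of the Krawtchouk series. -/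
lemma genPoly_eq_sum (h0 : 0 < p) (h1 : p < 1) (σ : ℝ) (x k : ℕ) :
    genPoly p σ x k = ∑ j ∈ Finset.range (x + 1),
      C (qBinom p x j * qPoch (-(p ^ (-σ) * (p ^ k)⁻¹)) p j * (p ^ k) ^ j) *
        ((∏ i ∈ Finset.range (x + k - j), (1 - C (p ^ i) * X)) * X ^ j) := by
  refine Polynomial.funext fun t ↦ ?_
  rw [eval_finsetSum, genPoly, eval_mul, eval_prod, eval_prod]
  have e1 : ∏ i ∈ Finset.range x, eval t (1 + C (p ^ (-σ) * p ^ i) * X) =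
      qPoch (-(p ^ (-σ) * (p ^ k)⁻¹) * (p ^ k * t)) p x := by
    refine Finset.prod_congr rfl fun i _ ↦ ?_
    have : p ^ k ≠ 0 := by positivity
    simp only [eval_add, eval_one, eval_mul, eval_C, eval_X]
    field_simp
    ring
  have e2 (m : ℕ) : ∏ i ∈ Finset.range m, eval t (1 - C (p ^ i) * X) = qPoch t p m := by
    refine Finset.prod_congr rfl fun i _ ↦ ?_
    simp only [eval_sub, eval_one, eval_mul, eval_C, eval_X]
    ring
  rw [e1, e2, qPoch_mul_eq_sum h0 h1, Finset.sum_mul]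
  refine Finset.sum_congr rfl fun j hj ↦ ?_
  have hj' : j ≤ x := Nat.lt_succ_iff.1 (Finset.mem_range.1 hj)
  rw [eval_mul, eval_mul, eval_prod, e2, eval_C, eval_pow, eval_X,
    show x + k - j = k + (x - j) by omega, qPoch_add t, mul_comm t]
  ring

lemma choose_two_add (j a : ℕ) : (j + a).choose 2 = j.choose 2 + a.choose 2 + j * a := by
  induction a with
  | zero => simp
  | succ a ih =>
    rw [← add_assoc, Nat.choose_succ_succ' (j + a) 1, Nat.choose_succ_succ' a 1, ih,
      Nat.choose_one_right, Nat.choose_one_right]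
    ring

lemma two_mul_choose_two_add (j : ℕ) : j.choose 2 + j.choose 2 + j = j * j := by
  induction j with
  | zero => simp
  | succ j ih =>
    rw [Nat.choose_succ_succ' j 1, Nat.choose_one_right]
    linarith

/-- With `n = j + a` and `M = n + b`, the quotient of `(p^{-n}; p)_j` by `(p^{-M}; p)_j` turns `[M,
n]` into `p^{bj} [M-j, n-j]`, the q-binomial that occurs in the coefficients of `(t; p)_{M-j}`. -/
lemma qBinom_mul_div (h0 : 0 < p) (h1 : p < 1) (j a b : ℕ) :
    qBinom p (j + a + b) (j + a) *
        (qPoch (p ^ (j + a))⁻¹ p j / qPoch (p ^ (j + a + b))⁻¹ p j) =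
      p ^ (b * j) * qBinom p (a + b) a := by
  have hs := qPoch_self_add h0 j a
  have hp := (qPoch_self_pos h0 h1 a).ne'
  have hq := (qPoch_pow_inv_pos h0 h1 (show j ≤ j + a from by omega)).ne'
  have hr := (qPoch_pow_inv_pos h0 h1 (show j ≤ j + a + b from by omega)).ne'
  have hm : p ^ (j + a + b) * p⁻¹ ^ j = p ^ (a + b) := by
    rw [add_assoc, pow_add, inv_pow]
    field_simp
  rw [qBinom, qBinom, hs, qPoch_add, hm, qPoch_inv h0 (by positivity), qPoch_inv h0 (by positivity)]
  have : (-1 : ℝ) ^ j ≠ 0 := by positivity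
  have hb : (p ^ (j + a + b)) ^ j = (p ^ (j + a)) ^ j * p ^ (b * j) := by
    rw [pow_add p (j + a) b, mul_pow, pow_mul]
  rw [hb]
  generalize p⁻¹ = r at *
  field_simp

/-- The generating function of the dual `q`-Krawtchouk polynomials. -/
lemma coeff_genPoly (h0 : 0 < p) (h1 : p < 1) (σ : ℝ) (x k n : ℕ) (hn : n ≤ x + k) :
    (genPoly p σ x k).coeff n = (-1) ^ n * p ^ (n.choose 2) *
      (qBinom p (x + k) n * dualKrawtchouk p σ (x + k) n x) := by
  have hy : -p ^ ((x : ℝ) - (x + k : ℕ) - σ) = -(p ^ (-σ) * (p ^ k)⁻¹) := by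
    rw [show (x : ℝ) - (x + k : ℕ) - σ = -σ + -(k : ℝ) by push_cast; ring, Real.rpow_add h0,
      Real.rpow_neg h0.le k, Real.rpow_natCast]
  rw [genPoly_eq_sum h0 h1, finsetSum_coeff, dualKrawtchouk, Finset.mul_sum, Finset.mul_sum]
  simp only [coeff_C_mul, coeff_mul_X_pow', hy, Real.rpow_neg h0.le, Real.rpow_natCast, zero_qPoch,
    mul_one]
  have hL : ∀ j, x < j → qBinom p x j = 0 := fun j hj ↦ qBinom_eq_zero h0 hj
  -- The two sums have different ranges: terms with `j > x` vanish through `[x, j]`, and terms with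
  -- `j > n` because `X ^ j` does not reach degree `n`.
  rw [Finset.sum_subset (Finset.range_subset_range.2 (show x + 1 ≤ x + n + 1 by omega)),
    ← Finset.sum_subset (Finset.range_subset_range.2 (show n + 1 ≤ x + n + 1 by omega))]
  · refine Finset.sum_congr rfl fun j hj ↦ ?_
    have hj' : j ≤ n := Nat.lt_succ_iff.1 (Finset.mem_range.1 hj)
    rw [if_pos hj', coeff_prod_one_sub h0 h1]
    obtain ⟨a, rfl⟩ := Nat.exists_eq_add_of_le hj'
    obtain ⟨b, hb⟩ := Nat.exists_eq_add_of_le hn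
    have hB := qBinom_mul_div h0 h1 j a b
    have hX : qPoch (p ^ x)⁻¹ p j =
        (-1) ^ j * ((p ^ x) ^ j)⁻¹ * p ^ (j.choose 2) * (qBinom p x j * qPoch p p j) := by
      rw [qPoch_inv h0 (by positivity), qBinom, div_mul_cancel₀ _ (qPoch_self_pos h0 h1 j).ne']
    -- The powers of `p` balance because `n = j + a` and `x + k = n + b`.
    have hpow : p ^ ((j + a).choose 2) * p ^ (b * j) * p ^ (j.choose 2) * p ^ j =
        p ^ (a.choose 2) * (p ^ x) ^ j * (p ^ k) ^ j := by
      rw [← pow_mul, ← pow_mul]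
      simp only [← pow_add]
      congr 1
      have h3 : (x + k) * j = (j + a + b) * j := by rw [hb]
      rw [choose_two_add]
      linarith [two_mul_choose_two_add j]
    have hs : (-1 : ℝ) ^ (j + a) * (-1) ^ j = (-1) ^ a := by
      rw [← pow_add, show j + a + j = a + 2 * j by ring, pow_add, pow_mul]
      simp
    rw [hb, show j + a + b - j = a + b by omega, show j + a - j = a by omega]
    have hpp := (qPoch_self_pos h0 h1 j).ne'
    have hx : (p ^ x) ^ j ≠ 0 := by positivity
    generalize qPoch (-((p ^ σ)⁻¹ * (p ^ k)⁻¹)) p j = Y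
    calc _ = qBinom p x j * Y * (qBinom p (a + b) a * (-1) ^ a *
          (p ^ (a.choose 2) * (p ^ x) ^ j * (p ^ k) ^ j)) / (p ^ x) ^ j := by
          field_simp
      _ = (-1) ^ (j + a) * p ^ (j + a).choose 2 * ((qBinom p (j + a + b) (j + a) *
          (qPoch (p ^ (j + a))⁻¹ p j / qPoch (p ^ (j + a + b))⁻¹ p j)) *
          ((-1) ^ j * ((p ^ x) ^ j)⁻¹ * p ^ (j.choose 2) * (qBinom p x j * qPoch p p j)) * Y /
            qPoch p p j * p ^ j) := by
          rw [hB, ← hpow, ← hs]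
          field_simp
      _ = _ := by
          rw [← hX]
          ring
  · intro j _ hj
    simp only [Finset.mem_range, not_lt] at hj
    rw [if_neg (by omega), mul_zero]
  · intro j _ hj
    simp only [Finset.mem_range, not_lt] at hj
    rw [hL j (by omega)]
    simp

end Krawtchouk

section Basis

open Polynomial

variable (q : Param)

/-! ### Comparison with the orthonormal basis -/

/-- The ratio between the basis vector `e_{l - n}` and the monomial `X ^ n`, `l = N / 2`. -/
def normFactor (N n : ℕ) : ℝ :=
  (q : ℝ) ^ (-((n : ℝ) * (N - n) / 2)) * √(qBinom ((q : ℝ) ^ 2) N n)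

lemma sq_lt_one : (q : ℝ) ^ 2 < 1 := pow_lt_one₀ q.2.1.le q.2.2 two_ne_zero

lemma sq_pos : 0 < (q : ℝ) ^ 2 := pow_pos q.2.1 2

lemma qBinom_sq_nonneg {N n : ℕ} (h : n ≤ N) : 0 ≤ qBinom ((q : ℝ) ^ 2) N n :=
  (qBinom_pos (sq_pos q) (sq_lt_one q) h).le

/-- The `q`-number as a real number. -/
def qNumReal (x : ℝ) : ℝ := ((q : ℝ) ^ (-x) - (q : ℝ) ^ x) / ((q : ℝ)⁻¹ - q)

lemma qNum_eq_ofReal (x : ℝ) : qNum q x = (qNumReal q x : ℂ) := by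
  simp [qNum, qNumReal, qpow, qc]

lemma inv_sub_pos : 0 < (q : ℝ)⁻¹ - q := by
  have := (one_lt_inv₀ q.2.1).2 q.2.2
  linarith [q.2.2]

lemma qNumReal_nonneg {x : ℝ} (hx : 0 ≤ x) : 0 ≤ qNumReal q x :=
  div_nonneg (sub_nonneg.2
    (Real.rpow_le_rpow_of_exponent_ge q.2.1 q.2.2.le (by linarith))) (inv_sub_pos q).le

lemma raiseCoeff_spin (N r : ℕ) : raiseCoeff q (spin N) (weight N r) =
    √(qNumReal q (N - r) * qNumReal q (r + 1)) := by
  have hd := inv_sub_pos q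
  have e1 : -spin N + weight N r = -((N : ℝ) - r) := by simp only [weight, spin]; ring
  have e2 : spin N - weight N r = (N : ℝ) - r := by simp only [weight, spin]; ring
  have e3 : -spin N - weight N r - 1 = -((r : ℝ) + 1) := by simp only [weight, spin]; ring
  have e4 : spin N + weight N r + 1 = (r : ℝ) + 1 := by simp only [weight, spin]; ring
  rw [raiseCoeff, e1, e2, e3, e4, qNumReal, qNumReal, div_mul_div_comm, ← sq, Real.sqrt_div',
    Real.sqrt_sq hd.le]
  positivity

lemma qNumReal_natCast (n : ℕ) :
    qNumReal q n = ((q : ℝ) ^ n)⁻¹ * (1 - ((q : ℝ) ^ 2) ^ n) / ((q : ℝ)⁻¹ - q) := by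
  have := q.2.1.ne'
  rw [qNumReal, Real.rpow_neg q.2.1.le, Real.rpow_natCast, ← pow_mul, mul_comm 2 n, pow_mul]
  field_simp

lemma normFactor_sq {N n : ℕ} (h : n ≤ N) :
    normFactor q N n ^ 2 = ((q : ℝ) ^ (n * (N - n)))⁻¹ * qBinom ((q : ℝ) ^ 2) N n := by
  rw [normFactor, mul_pow, Real.sq_sqrt (qBinom_sq_nonneg q h), ← Real.rpow_natCast,
    ← Real.rpow_mul q.2.1.le, ← Real.rpow_natCast _ (n * (N - n)), ← Real.rpow_neg q.2.1.le]
  congr 2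
  push_cast [Nat.cast_sub h]
  ring

lemma normFactor_nonneg (N n : ℕ) : 0 ≤ normFactor q N n :=
  mul_nonneg (Real.rpow_nonneg q.2.1.le _) (Real.sqrt_nonneg _)

/-- This is `[N, n+1](1 - p^{n+1}) = [N, n](1 - p^{N-n})` for `N = r + n + 1`; the powers of `q`
agree since both total exponents are `(n+1)(r+1)`. It is the recursion that makes the rescaled
monomials orthonormal. -/
lemma normFactor_sq_mul (r n : ℕ) :
    normFactor q (r + (n + 1)) (n + 1) ^ 2 * qNumReal q (n + 1 : ℕ) =
      normFactor q (r + (n + 1)) n ^ 2 * qNumReal q (r + 1 : ℕ) := by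
  have hq := q.2.1
  rw [normFactor_sq q (by omega), normFactor_sq q (by omega), qNumReal_natCast, qNumReal_natCast]
  have hp := (qPoch_self_pos (sq_pos q) (sq_lt_one q) (n + 1)).ne'
  have hb : qBinom ((q : ℝ) ^ 2) (r + (n + 1)) (n + 1) * (1 - ((q : ℝ) ^ 2) ^ (n + 1)) =
      qBinom ((q : ℝ) ^ 2) (r + (n + 1)) n * (1 - ((q : ℝ) ^ 2) ^ (r + 1)) := by
    have e : ((q : ℝ) ^ 2) ^ (r + (n + 1)) * ((q : ℝ) ^ 2)⁻¹ ^ n = ((q : ℝ) ^ 2) ^ (r + 1) := by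
      rw [inv_pow]
      field_simp
      ring
    rw [qBinom, qBinom, qPoch_succ, qPoch_succ, e]
    rw [qPoch_succ] at hp
    have h1 := left_ne_zero_of_mul hp
    have h2 := right_ne_zero_of_mul hp
    rw [pow_succ' _ n]
    field_simp
  have e1 : (n + 1) * (r + (n + 1) - (n + 1)) + (n + 1) = (n + 1) * (r + 1) := by
    rw [Nat.add_sub_cancel]; ring
  have e2 : n * (r + (n + 1) - n) + (r + 1) = (n + 1) * (r + 1) := by
    rw [show r + (n + 1) - n = r + 1 by omega]; ring
  have key (a : ℕ) (b : ℕ) (x y d : ℝ) : ((q : ℝ) ^ a)⁻¹ * x * (((q : ℝ) ^ b)⁻¹ * y / d) =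
      ((q : ℝ) ^ (a + b))⁻¹ * (x * y) / d := by
    rw [pow_add, mul_inv]; ring
  rw [key, key, e1, e2, hb]

lemma sqrt_mul_eq {a b x y : ℝ} (ha : 0 ≤ a) (hx : 0 ≤ x) (hy : 0 ≤ y)
    (h : x ^ 2 * a = y ^ 2 * b) : √(a * b) * y = a * x := by
  have : a * b * y ^ 2 = (a * x) ^ 2 := by linear_combination -a * h
  rw [← Real.sqrt_sq hy, ← Real.sqrt_mul' _ (sq_nonneg y), this, Real.sqrt_sq (mul_nonneg ha hx)]

/-- In the orthonormal basis `B` and `C` share the coefficient `√([N-r][r+1])`. Rescaling removes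
the root and leaves a single q-number: the first identity serves `C`, the second `B`. -/
lemma raiseCoeff_mul_normFactor (N r : ℕ) (h : r < N) :
    raiseCoeff q (spin N) (weight N r) * normFactor q N (N - (r + 1)) =
      qNumReal q (N - r) * normFactor q N (N - r) ∧
    raiseCoeff q (spin N) (weight N r) * normFactor q N (N - r) =
      qNumReal q (r + 1) * normFactor q N (N - (r + 1)) := by
  obtain ⟨n, rfl⟩ := Nat.exists_eq_add_of_lt h
  have key := normFactor_sq_mul q r n
  rw [raiseCoeff_spin q _ r, add_assoc r n 1, show r + (n + 1) - (r + 1) = n by omega,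
    show r + (n + 1) - r = n + 1 by omega,
    show ((r + (n + 1) : ℕ) : ℝ) - r = (n + 1 : ℕ) by push_cast; ring]
  have e : ((r : ℝ) + 1) = (r + 1 : ℕ) := by push_cast; ring
  rw [e]
  refine ⟨sqrt_mul_eq (qNumReal_nonneg q (Nat.cast_nonneg _)) (normFactor_nonneg q _ _)
    (normFactor_nonneg q _ _) key, ?_⟩
  rw [mul_comm (qNumReal _ _)]
  exact sqrt_mul_eq (qNumReal_nonneg q (Nat.cast_nonneg _)) (normFactor_nonneg q _ _)
    (normFactor_nonneg q _ _) key.symm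

/-- The identification of the orthonormal model with polynomials. -/
def toPoly (N : ℕ) : (Fin (N + 1) → ℂ) →ₗ[ℂ] ℂ[X] :=
  ∑ r : Fin (N + 1), LinearMap.smulRight (LinearMap.proj r)
    ((normFactor q N (N - r) : ℂ) • (X : ℂ[X]) ^ (N - (r : ℕ)))

lemma toPoly_apply (N : ℕ) (v : Fin (N + 1) → ℂ) :
    toPoly q N v = ∑ r : Fin (N + 1),
      (v r * (normFactor q N (N - r) : ℂ)) • (X : ℂ[X]) ^ (N - (r : ℕ)) := by
  simp only [toPoly, LinearMap.sum_apply, LinearMap.smulRight_apply, LinearMap.proj_apply,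
    smul_smul]

lemma toPoly_single (N : ℕ) (s : Fin (N + 1)) : toPoly q N (Pi.single s 1) =
    (normFactor q N (N - s) : ℂ) • (X : ℂ[X]) ^ (N - (s : ℕ)) := by
  rw [toPoly_apply, Finset.sum_eq_single s]
  · simp
  · intro r _ hr
    simp [hr]
  · simp

lemma toPoly_spinRepGen (N : ℕ) (x : UGen) (s : Fin (N + 1)) :
    toPoly q N (spinRepGen q N x *ᵥ Pi.single s 1) =
      polyRepGen q N x (toPoly q N (Pi.single s 1)) := by
  have hs : (s : ℕ) ≤ N := by omega
  rw [toPoly_single, Matrix.mulVec_single_one, toPoly_apply, map_smul]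
  cases x with
  | A =>
    rw [Finset.sum_eq_single s]
    · simp only [spinRepGen, polyRepGen, onMono_X_pow, Matrix.col_apply, Matrix.diagonal_apply_eq,
        smul_smul]
      rw [mul_comm]
      congr 3
      rw [Nat.cast_sub hs]
      simp only [weight, spin]
      ring
    · intro r _ hr
      simp [spinRepGen, Matrix.col_apply, Matrix.diagonal_apply_ne _ hr]
    · simp
  | D =>
    rw [Finset.sum_eq_single s]
    · simp only [spinRepGen, polyRepGen, onMono_X_pow, Matrix.col_apply, Matrix.diagonal_apply_eq,
        smul_smul]
      rw [mul_comm]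
      congr 3
      rw [Nat.cast_sub hs]
      simp only [weight, spin]
      ring
    · intro r _ hr
      simp [spinRepGen, Matrix.col_apply, Matrix.diagonal_apply_ne _ hr]
    · simp
  | B =>
    obtain ⟨s, hs'⟩ := s
    simp only [spinRepGen, polyRepGen, onMono_X_pow, Matrix.col_apply, Matrix.of_apply] at hs ⊢
    rcases s with _ | s
    · rw [Finset.sum_eq_zero]
      · simp [qNum_zero]
      · intro r _
        simp
    · rw [Finset.sum_eq_single (⟨s, by omega⟩ : Fin (N + 1))]
      · rw [if_pos rfl, lowerCoeff_eq, weight_succ, add_sub_cancel_right, smul_smul,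
          qNum_eq_ofReal, ← Complex.ofReal_mul, ← Complex.ofReal_mul,
          (raiseCoeff_mul_normFactor q N s (by omega)).2, show N - (s + 1) + 1 = N - s by omega,
          mul_comm]
        congr 4
        rw [Nat.cast_sub hs]
        push_cast
        ring
      · intro r _ hr
        rw [if_neg (fun h ↦ hr (by ext; simp at h ⊢; omega)), zero_mul, zero_smul]
      · simp
  | C =>
    obtain ⟨s, hs'⟩ := s
    simp only [spinRepGen, polyRepGen, onMono_X_pow, Matrix.col_apply, Matrix.of_apply] at hs ⊢
    rcases hs.eq_or_lt with rfl | hlt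
    · rw [Finset.sum_eq_zero]
      · simp [qNum_zero]
      · intro r _
        rw [if_neg (by omega), zero_mul, zero_smul]
    · rw [Finset.sum_eq_single (⟨s + 1, by omega⟩ : Fin (N + 1))]
      · rw [if_pos rfl, smul_smul,
          qNum_eq_ofReal, ← Complex.ofReal_mul, ← Complex.ofReal_mul,
          (raiseCoeff_mul_normFactor q N s hlt).1, show N - (s + 1) = N - s - 1 by omega,
          mul_comm, Nat.cast_sub hs]
      · intro r _ hr
        rw [if_neg (fun h ↦ hr (by ext; simp at h ⊢; omega)), zero_mul, zero_smul]
      · simp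

lemma spinRep_gen (N : ℕ) (x : UGen) : spinRep q N (Uq.gen q x) = spinRepGen q N x := by
  simp [spinRep]

lemma toPoly_spinRep (N : ℕ) (Y : Uq q) (v : Fin (N + 1) → ℂ) :
    toPoly q N (spinRep q N Y *ᵥ v) = polyRep q N Y (toPoly q N v) := by
  induction Y using Uq.induction generalizing v with
  | hc c => simp [Algebra.algebraMap_eq_smul_one, Matrix.smul_mulVec]
  | hg x =>
    have : toPoly q N ∘ₗ (spinRepGen q N x).mulVecLin = polyRepGen q N x ∘ₗ toPoly q N := by
      refine (Pi.basisFun ℂ (Fin (N + 1))).ext fun s ↦ ?_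
      rw [Pi.basisFun_apply]
      exact toPoly_spinRepGen q N x s
    rw [spinRep_gen, polyRep_gen]
    exact LinearMap.congr_fun this v
  | hadd x y hx hy => rw [map_add, Matrix.add_mulVec, map_add, hx, hy, map_add, LinearMap.add_apply]
  | hmul x y hx hy => rw [map_mul, ← Matrix.mulVec_mulVec, hx, hy, map_mul, Module.End.mul_apply]

end Basis

/-! ### The eigenvectors in the polynomial model and the product formula -/

section Comparison

open Polynomial

variable (q : Param)

lemma toPoly_coeff (N : ℕ) (v : Fin (N + 1) → ℂ) (n : ℕ) (hn : n ≤ N) :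
    (toPoly q N v).coeff n = v ⟨N - n, by omega⟩ * (normFactor q N n : ℂ) := by
  rw [toPoly_apply, finsetSum_coeff, Finset.sum_eq_single (⟨N - n, by omega⟩ : Fin (N + 1))]
  · simp [show N - (N - n) = n by omega]
  · intro r _ hr
    rw [coeff_smul, coeff_X_pow, if_neg, smul_zero]
    intro h
    exact hr (by ext; simp; omega)
  · simp

lemma toPoly_coeff_eq_zero (N : ℕ) (v : Fin (N + 1) → ℂ) (n : ℕ) (hn : N < n) :
    (toPoly q N v).coeff n = 0 := by
  rw [toPoly_apply, finsetSum_coeff]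
  refine Finset.sum_eq_zero fun r _ ↦ ?_
  rw [coeff_smul, coeff_X_pow, if_neg (by omega), smul_zero]

lemma natDegree_genPoly_le (p σ : ℝ) (x k : ℕ) : (genPoly p σ x k).natDegree ≤ x + k := by
  have h (s : Finset ℕ) (f : ℕ → ℝ[X]) (hf : ∀ i, (f i).natDegree ≤ 1) :
      (∏ i ∈ s, f i).natDegree ≤ s.card :=
    (natDegree_prod_le _ _).trans ((Finset.sum_le_sum fun i _ ↦ hf i).trans (by simp))
  refine natDegree_mul_le.trans (add_le_add ?_ ?_)
  · simpa using h (Finset.range x) (fun i ↦ 1 + C (p ^ (-σ) * p ^ i) * X)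
      fun i ↦ by compute_degree
  · simpa using h (Finset.range k) (fun i ↦ 1 - C (p ^ i) * X) fun i ↦ by compute_degree

lemma columnPoly_coeff (σ : ℝ) (x k n : ℕ) : (columnPoly q σ x k).coeff n =
    qpow q (σ * x - x * (x - 1) / 2 - (x + k) / 2) *
      (((genPoly ((q : ℝ) ^ 2) σ x k).coeff n : ℂ) *
        (Complex.I ^ n * qpow q (n * (σ + (3 - (x + k)) / 2)))) := by
  rw [columnPoly, coeff_C_mul, comp_C_mul_X_coeff, coeff_map, mul_pow, qpow_pow]
  rfl

lemma eigenVec_apply (N k n : ℕ) (hn : n ≤ N) (σ : ℝ) :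
    eigenVec q N k σ ⟨N - n, by omega⟩ = (normConst q N k σ : ℂ) * (-Complex.I) ^ n *
      (qpow q (σ * n) * qpow q (1 / 2 * n * (n - 1)) *
        (√(qBinom ((q : ℝ) ^ 2) N n) : ℂ) *
        (dualKrawtchouk ((q : ℝ) ^ 2) σ N n (N - k) : ℂ)) := by
  have hI : Complex.I ^ (-(n : ℤ)) = (-Complex.I) ^ n := by
    rw [zpow_neg, zpow_natCast, ← inv_pow, Complex.inv_I]
  simp only [eigenVec, show N - (N - n) = n by omega, hI, qpow, qBinom, ← pow_mul]
  push_cast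
  rfl

lemma sqrt_mul_sqrt_qBinom {N n : ℕ} (hn : n ≤ N) :
    (√(qBinom ((q : ℝ) ^ 2) N n) : ℂ) * (√(qBinom ((q : ℝ) ^ 2) N n) : ℂ) =
      (qBinom ((q : ℝ) ^ 2) N n : ℂ) := by
  rw [← Complex.ofReal_mul, Real.mul_self_sqrt (qBinom_sq_nonneg q hn)]

lemma neg_I_pow (n : ℕ) : (-Complex.I) ^ n = (-1) ^ n * Complex.I ^ n := by
  rw [← mul_pow, neg_one_mul]

/-- The vector `t(A) v` corresponds to the column of the product formula. -/
lemma toPoly_eigenVec (σ : ℝ) (x k : ℕ) :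
    toPoly q (x + k) (spinRepGen q (x + k) .A *ᵥ eigenVec q (x + k) k σ) =
      ((normConst q (x + k) k σ : ℂ) * qpow q (-(σ * x) + x * (x - 1) / 2)) •
        columnPoly q σ x k := by
  ext n
  rw [coeff_smul, columnPoly_coeff, smul_eq_mul]
  rcases lt_or_ge (x + k) n with hn | hn
  · rw [toPoly_coeff_eq_zero q _ _ _ hn,
      coeff_eq_zero_of_natDegree_lt ((natDegree_genPoly_le _ _ _ _).trans_lt hn)]
    simp
  rw [toPoly_coeff q _ _ _ hn, spinRepGen, Matrix.mulVec_diagonal, eigenVec_apply q _ _ _ hn,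
    coeff_genPoly (sq_pos q) (sq_lt_one q) σ x k n hn, Nat.add_sub_cancel]
  have hb := sqrt_mul_sqrt_qBinom q hn
  rw [normFactor]
  push_cast
  -- The q-binomial of the generating function is split into two roots, one from the eigenvector and
  -- one from `normFactor`; its sign `(-1)^n` comes from `(-i)^n`.
  rw [← hb, neg_I_pow]
  have e1 : (((q : ℝ) : ℂ) ^ 2) ^ (n.choose 2) = qpow q (n * (n - 1)) := by
    have := qc_sq_pow q (n.choose 2)
    push_cast at this
    rw [this, Nat.cast_choose_two]
    congr 1
    ring
  have e2 : (((q : ℝ) ^ (-((n : ℝ) * ((x : ℝ) + k - n) / 2)) : ℝ) : ℂ) =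
    qpow q (-((n : ℝ) * ((x : ℝ) + k - n) / 2)) := rfl
  have key : qpow q (-weight (x + k) (x + k - n)) * (qpow q (σ * n) *
      qpow q (1 / 2 * n * (n - 1))) * qpow q (-((n : ℝ) * ((x : ℝ) + k - n) / 2)) =
      qpow q (-(σ * x) + x * (x - 1) / 2) * qpow q (σ * x - x * (x - 1) / 2 - (x + k) / 2) *
        (qpow q (n * (n - 1)) * qpow q (n * (σ + (3 - (x + k)) / 2))) := by
    simp only [← qpow_add]
    congr 1
    simp only [weight, spin]
    rw [Nat.cast_sub hn]
    push_cast
    ring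
  rw [e1, e2]
  linear_combination ((normConst q (x + k) k σ : ℂ) * ((-1) ^ n * Complex.I ^ n) *
    (dualKrawtchouk ((q : ℝ) ^ 2) σ (x + k) n x : ℂ) * (√(qBinom ((q : ℝ) ^ 2) (x + k) n) : ℂ) ^ 2)
    * key

/-- All terms beyond the first contain `(1; p)_j = 0`. This is what makes the extremal eigenvector
explicit. -/
lemma dualKrawtchouk_zero (p s : ℝ) (M n : ℕ) : dualKrawtchouk p s M n 0 = 1 := by
  rw [dualKrawtchouk, Finset.sum_eq_single 0]
  · simp [qPoch_zero]
  · intro j _ hj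
    obtain ⟨j, rfl⟩ := Nat.exists_eq_succ_of_ne_zero hj
    have : qPoch (p ^ (-((0 : ℕ) : ℝ))) p (j + 1) = 0 := by
      rw [qPoch_succ']; simp
    rw [Nat.succ_eq_add_one, this]
    simp
  · simp

/-- Pairing with the extremal eigenvector is evaluation at a point. -/
lemma star_eigenVec_dotProduct (N : ℕ) (τ : ℝ) (v : Fin (N + 1) → ℂ) :
    star (eigenVec q N N τ) ⬝ᵥ v = (normConst q N N τ : ℂ) *
      (toPoly q N v).eval (Complex.I * qpow q (τ + (N - 1) / 2)) := by
  rw [dotProduct, toPoly_apply, eval_finsetSum, Finset.mul_sum]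
  refine Finset.sum_congr rfl fun r _ ↦ ?_
  obtain ⟨n, hn, rfl⟩ : ∃ n, ∃ hn : n ≤ N, r = ⟨N - n, by omega⟩ :=
    ⟨N - r, by omega, by ext; simp; omega⟩
  rw [Pi.star_apply, eigenVec_apply q _ _ _ hn, Nat.sub_self, dualKrawtchouk_zero,
    eval_smul, eval_pow, eval_X, show N - (N - n) = n by omega, normFactor, mul_pow, qpow_pow]
  have hstar (z : ℝ) : star (qpow q z) = qpow q z := Complex.conj_ofReal _
  have hreal (z : ℝ) : star (z : ℂ) = z := Complex.conj_ofReal _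
  -- Conjugation turns `(-i)^n` into `i^n`, whence the factor `i` in the evaluation point.
  have hI : star (-Complex.I) = Complex.I := by simp
  simp only [star_mul', star_pow, hstar, hreal, hI, smul_eq_mul, Complex.ofReal_mul,
    Complex.ofReal_one, mul_one]
  have key : qpow q (τ * n) * qpow q (1 / 2 * n * (n - 1)) =
      qpow q (-((n : ℝ) * (N - n) / 2)) * qpow q (n * (τ + (N - 1) / 2)) := by
    rw [← qpow_add, ← qpow_add]
    congr 1
    ring
  change _ = _ * (v _ * (qpow q (-((n : ℝ) * (N - n) / 2)) * _) * _)
  linear_combination ((normConst q N N τ : ℂ) * Complex.I ^ n *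
    (√(qBinom ((q : ℝ) ^ 2) N n) : ℂ) * v ⟨N - n, by omega⟩) * key

/-- The product formula in terms of functionals. -/
lemma genMatFunctional_mul_A (τ σ : ℝ) (x k : ℕ) (Y : Uq q) :
    genMatFunctional q (x + k) (x + k) k τ σ (Y * Uq.gen q .A) =
      pairing q Y (((normConst q (x + k) k σ : ℂ) * (normConst q (x + k) (x + k) τ : ℂ) *
        qpow q (-(σ * x) + x * (x - 1) / 2)) • (deltaProd q τ σ x k * gammaProd q τ σ x)) := by
  rw [genMatFunctional, map_mul, ← Matrix.mulVec_mulVec, star_eigenVec_dotProduct, toPoly_spinRep,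
    spinRep_gen, toPoly_eigenVec, map_smul, eval_smul, map_smul, isEvalElt_prod q τ σ x k Y,
    smul_eq_mul, smul_eq_mul]
  ring

/-- Since `⟨Y, A.a⟩ = ⟨YA, a⟩` and `D` inverts `A`, prescribing `a` as a functional amounts to
prescribing `A.a`. So `a = D.b` works, and injectivity of the pairing gives the rest. -/
lemma existsUnique_of_mul_A {f : Uq q → ℂ} {b : Aq q}
    (h : ∀ Y, f (Y * Uq.gen q .A) = pairing q Y b) :
    (∃! a : Aq q, ∀ Y, pairing q Y a = f Y) ∧
      ∀ a : Aq q, (∀ Y, pairing q Y a = f Y) → leftAct q (Uq.gen q .A) a = b := by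
  have hinj {a a' : Aq q} (haa : ∀ Y, pairing q Y a = pairing q Y a') : a = a' :=
    pairingHom_injective q (Dual.ext_ev haa)
  refine ⟨⟨leftAct q (Uq.gen q .D) b, fun Y ↦ ?_, fun a ha ↦ hinj fun Y ↦ ?_⟩, fun a ha ↦
    hinj fun Y ↦ ?_⟩
  · rw [(isGrp_D q).pairing_leftAct, ← h, mul_assoc, Uq.DA, mul_one]
  · rw [ha, (isGrp_D q).pairing_leftAct, ← h, mul_assoc, Uq.DA, mul_one]
  · rw [(isGrp_A q).pairing_leftAct, ha, h]

end Comparison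

end QSU2

end

theorem corollary6p7 (q : QSU2.Param) (N k : ℕ) (hk : k ≤ N) (l m τ σ : ℝ)
    (hl : l = QSU2.spin N) (hm : m = QSU2.weight N k) :
    (∃! a : QSU2.Aq q, QSU2.IsGenMatElt q N N k τ σ a) ∧
    ∀ a : QSU2.Aq q, QSU2.IsGenMatElt q N N k τ σ a →
      QSU2.leftAct q (QSU2.Uq.gen q .A) a =
        (QSU2.extremalConst q N k τ σ : ℂ) •
          (((List.range k).map fun p : ℕ ↦
              QSU2.deltaElt q (τ + 2 * l - 1 - p) (σ + 2 * m - 1 - p)).prod *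
            ((List.range (N - k)).map fun j : ℕ ↦
              QSU2.gammaElt q (τ + l - m - 1 - j) (σ - l + m + 1 + j)).prod) := by
  -- Here `x = l - m` counts the factors `γ` and `k = l + m` the factors `δ`.
  obtain ⟨x, rfl⟩ := Nat.exists_eq_add_of_le' hk
  have hδ : ((List.range k).map fun p : ℕ ↦
      QSU2.deltaElt q (τ + 2 * l - 1 - p) (σ + 2 * m - 1 - p)).prod =
      QSU2.deltaProd q τ σ x k := by
    refine congrArg List.prod (List.map_congr_left fun p _ ↦ ?_)
    rw [hl, hm]
    congr 1 <;> · simp only [QSU2.weight, QSU2.spin]; push_cast; ring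
  have hγ : ((List.range x).map fun j : ℕ ↦
      QSU2.gammaElt q (τ + l - m - 1 - j) (σ - l + m + 1 + j)).prod =
      QSU2.gammaProd q τ σ x := by
    refine congrArg List.prod (List.map_congr_left fun p _ ↦ ?_)
    rw [hl, hm]
    congr 1 <;> · simp only [QSU2.weight, QSU2.spin]; push_cast; ring
  have hE : (QSU2.extremalConst q (x + k) k τ σ : ℂ) =
      (QSU2.normConst q (x + k) k σ : ℂ) * (QSU2.normConst q (x + k) (x + k) τ : ℂ) *
        QSU2.qpow q (-(σ * x) + x * (x - 1) / 2) := by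
    rw [QSU2.qpow_add, QSU2.extremalConst]
    push_cast
    rw [mul_assoc _ (Complex.ofReal _) (Complex.ofReal _), QSU2.qpow, QSU2.qpow]
    congr 4 <;> · simp only [QSU2.weight, QSU2.spin]; push_cast; ring
  rw [Nat.add_sub_cancel, hδ, hγ, hE]
  exact QSU2.existsUnique_of_mul_A q (QSU2.genMatFunctional_mul_A q τ σ x k)
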